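/- Let $X$ be a non-empty locally compact Hausdorff space with Borel $\sigma$-algebra $\mathscr B$, and let $E$ be an order continuous Banach lattice, with positive cone $E^+$. An $E^+$-valued measure is a map $\nu\colon\mathscr B\to E^+$ with $\nu(\emptyset)=0$ and $\nu(\bigcup_n\Delta_n)=\sup_N\sum_{n\le N}\nu(\Delta_n)$ for every pairwise disjoint sequence $(\Delta_n)$ in $\mathscr B$. It is regular if $\nu(V)=\sup\{\nu(K): K\subseteq V \text{ compact}\}$ for all open $V$ and $\nu(\Delta)=\inf\{\nu(V): V\supseteq\Delta\text{ open}\}$ for all $\Delta\in\mathscr B$. Let $M(X,\mathscr B,E)$ (resp. $M_{rB}(X,\mathscr B,E)$) be the linear span of the $E^+$-valued measures (resp. of the regular ones) in the space of all maps $\mathscr B\to E$, with the pointwise order and the norm $\|\mu\|=\|\,|\mu|(X)\,\|$, where $|\mu|$ is the modulus of $\mu$ in $M(X,\mathscr B,E)$. For $F=C_c(X)$ or $F=C_0(X)$ (real-valued functions, uniform norm, pointwise order), let $L_{nob}(F,E)$ be the space of linear operators $T\colon F\to E$ that map norm bounded sets to order bounded sets, with the order $S\le T\iff Sf\le Tf$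 for all $f\ge 0$, and with the regular norm $\|T\|_r=\inf\{\|S\|:\ S\colon F\to E \text{ bounded linear},\ \pm T\le S\}=\|\,|T|\,\|$. For an $E^+$-valued measure $\nu$, the order integral of an elementary function is $\int\sum_i r_i\chi_{\Delta_i}\,d\nu=\sum_i r_i\nu(\Delta_i)$ (with $r_i\ge 0$); for bounded measurable $f\ge 0$, $\int f\,d\nu=\sup_n\int\varphi_n\,d\nu$ for any sequence of elementary functions $\varphi_n\uparrow f$ pointwise; $\int f\,d\nu=\int f^+d\nu-\int f^-d\nu$ for bounded measurable real-valued $f$. For $\mu=\nu_1-\nu_2$ with $E^+$-valued measures $\nu_1,\nu_2$, put $I_\mu(f)=\int f\,d\nu_1-\int f\,d\nu_2$. Then $M_{rB}(X,\mathscr B,E)$, $L_{nob}(C_c(X),E)$ and $L_{nob}(C_0(X),E)$ are Banach lattices, and the maps (1) $\mu\mapsto I_\mu$ from $M_{rB}(X,\mathscr B,E)$ to $L_{nob}(C_c(X),E)$, and (2) $\mu\mapsto I_\mu$ from $M_{rB}(X,\mathscr B,E)$ to $L_{nob}(C_0(X),E)$ are isometric surjective vector lattice isomorphisms. Each of these Banach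 lattices is an AL-space (respectively, has a Levi norm, respectively, is a KB-space) if and only if $E$ has that property. Here an AL-space is a Banach lattice whose norm is additive on the positive cone; a Banach lattice has a Levi norm if every norm bounded increasing net in its positive cone has a supremum, and is a KB-space if every such net is norm convergent. When $X$ is compact, $L_{nob}(C_0(X),E)$ and $L_{nob}(C_c(X),E)$ both coincide with the space $L_r(C(X),E)$ of regular operators (differences of positive operators). -/

import Mathlib

open Set Filter Topology
open scoped NNReal CompactlySupported ZeroAtInfty

namespace VectorRiesz

noncomputable section

/-! ### Banach lattices and their special classes

The spaces of measures and of operators below are ordered vector spaces `V` with a norm function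
`N : V → ℝ`; that they are Banach lattices is a claim about them. The notions are therefore
predicates on such pairs, which are applied to `E` itself with `N = ‖·‖`. -/

section BanachLattices

variable (V : Type*) [AddCommGroup V] [Module ℝ V] [Preorder V] (N : V → ℝ)

/-- `V` with the norm `N` is a Banach lattice: an ordered real vector space that is a lattice,
with a lattice norm in which it is complete. -/
structure IsBanachLattice : Prop where
  le_antisymm : ∀ u v : V, u ≤ v → v ≤ u → u = v
  add_le_add_right : ∀ u v w : V, u ≤ v → u + w ≤ v + w
  smul_nonneg : ∀ (r : ℝ) (v : V), 0 ≤ r → 0 ≤ v → 0 ≤ r • v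
  exists_sup : ∀ u v : V, ∃ s, IsLUB {u, v} s
  exists_inf : ∀ u v : V, ∃ s, IsGLB {u, v} s
  norm_nonneg : ∀ v : V, 0 ≤ N v
  norm_eq_zero : ∀ v : V, N v = 0 ↔ v = 0
  norm_smul : ∀ (r : ℝ) (v : V), N (r • v) = |r| * N v
  norm_add_le : ∀ u v : V, N (u + v) ≤ N u + N v
  /-- `|u| ≤ |v|` implies `N u ≤ N v`, where `|u| = u ⊔ -u`. -/
  norm_solid : ∀ u v a b : V, IsLUB {u, -u} a → IsLUB {v, -v} b → a ≤ b → N u ≤ N v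
  complete : ∀ x : ℕ → V,
    (∀ ε > 0, ∃ n₀, ∀ m ≥ n₀, ∀ n ≥ n₀, N (x m - x n) < ε) →
      ∃ v, ∀ ε > 0, ∃ n₀, ∀ n ≥ n₀, N (x n - v) < ε

/-- The norm is additive on the positive cone. -/
def IsALNorm : Prop :=
  ∀ u v : V, 0 ≤ u → 0 ≤ v → N (u + v) = N u + N v

/-- Levi norm: every norm bounded increasing net in the positive cone has a supremum.
Nets are represented by their ranges, which are non-empty upward directed sets. -/
def IsLeviNorm : Prop :=
  ∀ D : Set V, D.Nonempty → DirectedOn (· ≤ ·) D → (∀ v ∈ D, 0 ≤ v) →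
    (∃ C : ℝ, ∀ v ∈ D, N v ≤ C) → ∃ s, IsLUB D s

/-- KB-space: every norm bounded increasing net in the positive cone is norm convergent. -/
def IsKBNorm : Prop :=
  ∀ D : Set V, D.Nonempty → DirectedOn (· ≤ ·) D → (∀ v ∈ D, 0 ≤ v) →
    (∃ C : ℝ, ∀ v ∈ D, N v ≤ C) →
      ∃ s : V, ∀ ε > 0, ∃ d ∈ D, ∀ d' ∈ D, d ≤ d' → N (d' - s) < ε

/-- Order continuous norm: `‖x_λ‖ → 0` for every net `x_λ ↓ 0`. -/
def IsOrderContinuousNorm : Prop :=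
  ∀ D : Set V, D.Nonempty → DirectedOn (· ≥ ·) D → IsGLB D 0 →
    ∀ ε > 0, ∃ d ∈ D, N d < ε

variable {V}

open Classical in
/-- The modulus `|v| = v ⊔ -v` (with value `0` if that supremum does not exist). -/
def modulus (v : V) : V :=
  if h : ∃ m, IsLUB {v, -v} m then h.choose else 0

variable {W : Type*} [AddCommGroup W] [Module ℝ W] [Preorder W]

/-- A linear bijection `Φ` from `(V, N)` onto `(W, N')` is an isometric isomorphism of
vector lattices. -/
structure IsIsometricLatticeIso (N : V → ℝ) (N' : W → ℝ) (Φ : V ≃ₗ[ℝ] W) : Prop where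
  map_le_map_iff : ∀ u v : V, Φ u ≤ Φ v ↔ u ≤ v
  map_sup : ∀ u v s : V, IsLUB {u, v} s → IsLUB {Φ u, Φ v} (Φ s)
  map_inf : ∀ u v s : V, IsGLB {u, v} s → IsGLB {Φ u, Φ v} (Φ s)
  isometric : ∀ v : V, N' (Φ v) = N v

end BanachLattices

/-! ### Measures with values in `E` -/

section Measures

variable (X : Type*) [MeasurableSpace X]
variable (E : Type*) [NormedAddCommGroup E] [NormedSpace ℝ E] [Lattice E]

/-- The `σ`-algebra of `X`, as a type. -/
abbrev MSet : Type _ := {s : Set X // MeasurableSet s}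

variable {X E}

/-- `ν` is a (finite) `E⁺`-valued measure; `σ`-additivity is in the sense of order. -/
structure IsPosMeasure (ν : MSet X → E) : Prop where
  nonneg : ∀ s, 0 ≤ ν s
  empty : ν ⟨∅, MeasurableSet.empty⟩ = 0
  iUnion : ∀ A : ℕ → MSet X, (∀ i j, i ≠ j → Disjoint (A i).1 (A j).1) →
    IsLUB (range fun n : ℕ => ∑ i ∈ Finset.range n, ν (A i))
      (ν ⟨⋃ i, (A i).1, MeasurableSet.iUnion fun i => (A i).2⟩)

/-- `ν` is an `E⁺`-valued regular Borel measure: inner regular at all open sets and outer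
regular at all Borel sets. (Values on compact sets are finite since `ν` is.) -/
structure IsPosRegularMeasure [TopologicalSpace X] (ν : MSet X → E) : Prop
    extends IsPosMeasure ν where
  innerRegular : ∀ V : MSet X, IsOpen V.1 →
    IsLUB {e | ∃ K : MSet X, IsCompact K.1 ∧ K.1 ⊆ V.1 ∧ ν K = e} (ν V)
  outerRegular : ∀ A : MSet X,
    IsGLB {e | ∃ V : MSet X, IsOpen V.1 ∧ A.1 ⊆ V.1 ∧ ν V = e} (ν A)

variable (X E)

/-- The `E`-valued measures: the span of the `E⁺`-valued ones in the space of all set functions.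
Its order is the pointwise one. -/
def measures : Submodule ℝ (MSet X → E) :=
  Submodule.span ℝ {ν | IsPosMeasure ν}

/-- The `E`-valued regular Borel measures. -/
def regularMeasures [TopologicalSpace X] : Submodule ℝ (MSet X → E) :=
  Submodule.span ℝ {ν | IsPosRegularMeasure ν}

variable {X E}

theorem regularMeasures_le [TopologicalSpace X] : regularMeasures X E ≤ measures X E :=
  Submodule.span_mono fun _ h => h.toIsPosMeasure

/-- `‖μ‖ = ‖ |μ|(X) ‖`, with `|μ|` the modulus of `μ` in the space of `E`-valued measures. -/
def measureNorm (μ : measures X E) : ℝ :=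
  ‖(modulus μ).1 ⟨univ, MeasurableSet.univ⟩‖

/-- The restriction of `measureNorm` to the regular Borel measures. -/
def regularMeasureNorm [TopologicalSpace X] (μ : regularMeasures X E) : ℝ :=
  measureNorm (Submodule.inclusion regularMeasures_le μ)

/-! ### The order integral -/

/-- `∑ᵢ rᵢ ν(Δᵢ)` for an elementary function `∑ᵢ rᵢ χ(Δᵢ)`. -/
def elementaryIntegral (ν : MSet X → E) (φ : MeasureTheory.SimpleFunc X ℝ≥0) : E :=
  ∑ r ∈ φ.range, (r : ℝ) • ν ⟨φ ⁻¹' {r}, φ.measurableSet_fiber r⟩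

/-- `a` is the order integral of `f ≥ 0`: the supremum of the integrals of a sequence of
elementary functions that increases pointwise to `f`. -/
def HasPosOrderIntegral (ν : MSet X → E) (f : X → ℝ≥0) (a : E) : Prop :=
  ∃ φ : ℕ → MeasureTheory.SimpleFunc X ℝ≥0,
    (∀ x, Monotone fun n => φ n x) ∧ (∀ x, Tendsto (fun n => φ n x) atTop (𝓝 (f x))) ∧
      IsLUB (range fun n => elementaryIntegral ν (φ n)) a

open Classical in
/-- The order integral of `f ≥ 0` with respect to an `E⁺`-valued measure. -/
def posOrderIntegral (ν : MSet X → E) (f : X → ℝ≥0) : E :=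
  if h : ∃ a, HasPosOrderIntegral ν f a then h.choose else 0

/-- `∫ f dν = ∫ f⁺ dν - ∫ f⁻ dν` for an `E⁺`-valued measure `ν`. -/
def realOrderIntegral (ν : MSet X → E) (f : X → ℝ) : E :=
  posOrderIntegral ν (fun x => (f x).toNNReal) - posOrderIntegral ν (fun x => (-f x).toNNReal)

section Decomposition

set_option linter.unusedSectionVars false

variable [IsOrderedAddMonoid E]

theorem isLUB_range_add {a b : ℕ → E} (ha : Monotone a) (hb : Monotone b) {α β : E}
    (hα : IsLUB (range a) α) (hβ : IsLUB (range b) β) :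
    IsLUB (range fun n => a n + b n) (α + β) := by
  refine ⟨?_, fun c hc => ?_⟩
  · rintro _ ⟨n, rfl⟩
    exact add_le_add (hα.1 ⟨n, rfl⟩) (hβ.1 ⟨n, rfl⟩)
  · have key : ∀ n m, a n + b m ≤ c := fun n m =>
      (add_le_add (ha (le_max_left n m)) (hb (le_max_right n m))).trans (hc ⟨max n m, rfl⟩)
    have h1 : ∀ m, α ≤ c - b m := fun m => hα.2 (by
      rintro _ ⟨n, rfl⟩
      exact le_sub_iff_add_le.2 (key n m))
    have h2 : β ≤ c - α := hβ.2 (by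
      rintro _ ⟨m, rfl⟩
      exact le_sub_comm.1 (h1 m))
    exact add_comm β α ▸ le_sub_iff_add_le.1 h2

theorem IsPosMeasure.monotone_sum {ν : MSet X → E} (h : IsPosMeasure ν) (A : ℕ → MSet X) :
    Monotone fun n : ℕ => ∑ i ∈ Finset.range n, ν (A i) :=
  monotone_nat_of_le_succ fun n => by
    rw [Finset.sum_range_succ]
    exact le_add_of_nonneg_right (h.nonneg _)

theorem IsPosMeasure.zero : IsPosMeasure (0 : MSet X → E) where
  nonneg _ := le_rfl
  empty := rfl
  iUnion A _ := by simp

theorem IsPosMeasure.add {ν ξ : MSet X → E} (h : IsPosMeasure ν) (k : IsPosMeasure ξ) :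
    IsPosMeasure (ν + ξ) where
  nonneg s := add_nonneg (h.nonneg s) (k.nonneg s)
  empty := by rw [Pi.add_apply, h.empty, k.empty, add_zero]
  iUnion A hA := by
    have := isLUB_range_add (h.monotone_sum A) (k.monotone_sum A) (h.iUnion A hA) (k.iUnion A hA)
    simpa [Finset.sum_add_distrib] using this

theorem IsPosMeasure.smul [IsOrderedModule ℝ E] {ν : MSet X → E} (h : IsPosMeasure ν) {r : ℝ}
    (hr : 0 ≤ r) : IsPosMeasure (r • ν) where
  nonneg s := smul_nonneg hr (h.nonneg s)
  empty := by rw [Pi.smul_apply, h.empty, smul_zero]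
  iUnion A hA := by
    obtain rfl | hr := hr.eq_or_lt
    · simp
    have := (OrderIso.smulRight hr (β := E)).isLUB_image'.2 (h.iUnion A hA)
    rw [← range_comp] at this
    simpa [Function.comp_def, Finset.smul_sum] using this

/-- Every `E`-valued measure is a difference of two `E⁺`-valued measures. -/
theorem exists_decomposition [IsOrderedModule ℝ E] (μ : measures X E) :
    ∃ ν : (MSet X → E) × (MSet X → E),
      IsPosMeasure ν.1 ∧ IsPosMeasure ν.2 ∧ μ.1 = ν.1 - ν.2 := by
  obtain ⟨μ, hμ⟩ := μ
  induction hμ using Submodule.span_induction with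
  | mem x h => exact ⟨(x, 0), h, .zero, by simp⟩
  | zero => exact ⟨(0, 0), .zero, .zero, by simp⟩
  | add x y _ _ hx hy =>
    obtain ⟨ν, h1, h2, h3⟩ := hx
    obtain ⟨ξ, k1, k2, k3⟩ := hy
    refine ⟨(ν.1 + ξ.1, ν.2 + ξ.2), h1.add k1, h2.add k2, ?_⟩
    simp only at h3 k3 ⊢
    rw [h3, k3]
    abel
  | smul r x _ hx =>
    obtain ⟨ν, h1, h2, h3⟩ := hx
    simp only at h3
    obtain hr | hr := le_total 0 r
    · exact ⟨(r • ν.1, r • ν.2), h1.smul hr, h2.smul hr, by simp [h3, smul_sub]⟩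
    · refine ⟨((-r) • ν.2, (-r) • ν.1), h2.smul (neg_nonneg.2 hr), h1.smul (neg_nonneg.2 hr), ?_⟩
      simp only [h3, smul_sub, neg_smul]
      abel

variable [IsOrderedModule ℝ E]

/-- `∫ f dμ = ∫ f dν₁ - ∫ f dν₂` for an `E`-valued measure `μ`, where `μ = ν₁ - ν₂` with
`E⁺`-valued measures `ν₁` and `ν₂`. -/
def orderIntegral (μ : measures X E) (f : X → ℝ) : E :=
  realOrderIntegral (exists_decomposition μ).choose.1 f -
    realOrderIntegral (exists_decomposition μ).choose.2 f

/-- The order integral with respect to a regular Borel measure. -/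
def regularOrderIntegral [TopologicalSpace X] (μ : regularMeasures X E) (f : X → ℝ) : E :=
  orderIntegral (Submodule.inclusion regularMeasures_le μ) f

end Decomposition

end Measures

/-! ### Operators on vector lattices of bounded functions

`F` is a space of bounded real-valued functions on `X`, with the pointwise order and the uniform
norm; it will be `C_c(X)`, `C₀(X)`, or `C(X)` with `X` compact. -/

section Operators

variable {X : Type*} {F : Type*} [AddCommGroup F] [Module ℝ F] [FunLike F X ℝ]
variable {E : Type*} [NormedAddCommGroup E] [NormedSpace ℝ E] [Lattice E]

/-- Positive operators. -/
def IsPositiveOperator (T : F →ₗ[ℝ] E) : Prop :=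
  ∀ f : F, (∀ x, 0 ≤ f x) → 0 ≤ T f

/-- Regular operators: differences of positive operators. -/
def IsRegularOperator (T : F →ₗ[ℝ] E) : Prop :=
  ∃ T₁ T₂ : F →ₗ[ℝ] E, IsPositiveOperator T₁ ∧ IsPositiveOperator T₂ ∧ T = T₁ - T₂

/-- Norm to order bounded operators: (uniform) norm bounded sets of functions are mapped to
order bounded sets. -/
def IsNormToOrderBounded (T : F →ₗ[ℝ] E) : Prop :=
  ∀ S : Set F, (∃ c : ℝ, ∀ f ∈ S, ∀ x, |f x| ≤ c) → ∃ e : E, ∀ f ∈ S, |T f| ≤ e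

variable (F E) in
/-- The space of norm to order bounded operators. -/
def nobOperators [IsOrderedAddMonoid E] [IsOrderedModule ℝ E] : Submodule ℝ (F →ₗ[ℝ] E) where
  carrier := {T | IsNormToOrderBounded T}
  zero_mem' S _ := ⟨0, fun f _ => by simp⟩
  add_mem' {T T'} hT hT' S hS := by
    obtain ⟨e, he⟩ := hT S hS
    obtain ⟨e', he'⟩ := hT' S hS
    exact ⟨e + e', fun f hf => (abs_add_le _ _).trans (add_le_add (he f hf) (he' f hf))⟩
  smul_mem' r T hT S hS := by
    obtain ⟨e, he⟩ := hT S hS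
    refine ⟨|r| • e, fun f hf => ?_⟩
    obtain ⟨h1, h2⟩ := abs_le'.1 (he f hf)
    obtain hr | hr := le_total 0 r
    · rw [abs_of_nonneg hr, LinearMap.smul_apply]
      refine abs_le'.2 ⟨smul_le_smul_of_nonneg_left h1 hr, ?_⟩
      rw [← smul_neg]
      exact smul_le_smul_of_nonneg_left h2 hr
    · rw [abs_of_nonpos hr, LinearMap.smul_apply]
      have hr' : 0 ≤ -r := neg_nonneg.2 hr
      refine abs_le'.2 ⟨?_, ?_⟩
      · rw [← neg_smul_neg]
        exact smul_le_smul_of_nonneg_left h2 hr'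
      · rw [← neg_smul]
        exact smul_le_smul_of_nonneg_left h1 hr'

/-- The usual order of operators: `T ≤ T'` if `T f ≤ T' f` for all `f ≥ 0`. -/
instance [IsOrderedAddMonoid E] [IsOrderedModule ℝ E] : Preorder (nobOperators F E) where
  le T T' := ∀ f : F, (∀ x, 0 ≤ f x) → T.1 f ≤ T'.1 f
  le_refl _ _ _ := le_rfl
  le_trans _ _ _ h h' f hf := (h f hf).trans (h' f hf)

/-- The regular norm `‖T‖ᵣ = inf {‖S‖ : ±T ≤ S}`, where `‖S‖` is the operator norm with respect
to the uniform norm on `F`. When `E` is Dedekind complete, `‖T‖ᵣ = ‖ |T| ‖`. -/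
def regularNorm (T : F →ₗ[ℝ] E) : ℝ :=
  sInf {c : ℝ | 0 ≤ c ∧ ∃ S : F →ₗ[ℝ] E,
    (∀ f : F, (∀ x, 0 ≤ f x) → T f ≤ S f ∧ -T f ≤ S f) ∧
      ∀ f : F, (∀ x, |f x| ≤ 1) → ‖S f‖ ≤ c}

end Operators

end

end VectorRiesz

open VectorRiesz

/-! Everything is reduced to scalar measures through the monotone continuous functionals `φ` on `E`.
They determine the order of `E` (`le_of_forall_monotone`, by Hahn–Banach separation from the closed
cone). Because the norm is order continuous, directed suprema and infima are norm limits, so each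
`φ` preserves them. Hence `φ ∘ ν` is a finite scalar measure for every `E⁺`-valued measure `ν`, and
`φ (∫ f dν)` is the ordinary integral of `f` against it (`map_realOrderIntegral`). Linearity and
monotonicity of the order integral follow.

Order continuity also makes `E` Dedekind complete, so two Riesz–Kantorovich constructions are
available. For measures, `A ↦ sup {ν B - ξ B : B ⊆ A}` is the positive part of `ν - ξ`. It is
dominated by `ν`, and a finitely additive positive set function dominated by a regular measure is
regular (`IsContent.isPosRegularMeasure_of_le`). So suprema of regular measures are the same among
the regular measures and among all measures. For operators on `C_c(X)`, `f ↦ sup {T g : 0 ≤ g ≤ f}`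
splits `T` into positive operators whose sum is the modulus.

A positive norm to order bounded `T` is represented by the classical formulas: `a V` is the supremum
of `T f` over test functions `f` for the open set `V`, and `ν A` is the infimum of `a V` over open
`V ⊇ A`. Composed with `φ`, these give the scalar Riesz measure of `φ ∘ T`, so `ν` inherits
σ-additivity and regularity (`exists_representation_of_isPositiveOperator`). Regularity shows that
integration reflects the order, hence is injective, and that the regular norm is at least `‖ |μ|(X)
‖`. The passage to `C₀(X)` is a density argument.

On the positive cone the norm of a measure is the norm of its total mass. The AL, Levi and KB
properties therefore go up by working setwise and come down along point masses. They reach the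
operator spaces through the isomorphisms. -/

namespace VectorRiesz

set_option linter.unusedSectionVars false

/-! ### Order continuous Banach lattices: norm limits, monotone functionals, Dedekind completeness.
-/

section OrderContinuity

variable {E : Type*} [NormedAddCommGroup E] [Lattice E] [IsOrderedAddMonoid E] [HasSolidNorm E]

/-- The positive part `x ⊔ 0` lies below `|y|` for each such `y`, so its norm is arbitrarily small.
This converts norm estimates into order relations. -/
theorem le_zero_of_forall_exists_norm_lt {x : E} (h : ∀ ε > 0, ∃ y, x ≤ y ∧ ‖y‖ < ε) : x ≤ 0 := by
  have h0 : x ⊔ 0 = 0 := by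
    by_contra hne
    obtain ⟨y, hxy, hy⟩ := h ‖x ⊔ 0‖ (norm_pos_iff.2 hne)
    have : ‖x ⊔ 0‖ ≤ ‖y‖ := norm_le_norm_of_abs_le_abs (by
      rw [abs_of_nonneg (le_sup_right : (0 : E) ≤ x ⊔ 0)]
      exact sup_le (hxy.trans (le_abs_self y)) (abs_nonneg y))
    linarith
  exact h0 ▸ le_sup_left

theorem isLUB_of_forall_exists_norm_sub_lt {D : Set E} {s : E} (hs : s ∈ upperBounds D)
    (h : ∀ ε > 0, ∃ d ∈ D, ‖s - d‖ < ε) : IsLUB D s := by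
  refine ⟨hs, fun u hu => sub_nonpos.1 (le_zero_of_forall_exists_norm_lt fun ε hε => ?_)⟩
  obtain ⟨d, hd, hd'⟩ := h ε hε
  exact ⟨s - d, sub_le_sub_left (hu hd) s, hd'⟩

theorem isGLB_of_forall_exists_norm_sub_lt {D : Set E} {s : E} (hs : s ∈ lowerBounds D)
    (h : ∀ ε > 0, ∃ d ∈ D, ‖d - s‖ < ε) : IsGLB D s := by
  refine ⟨hs, fun u hu => sub_nonpos.1 (le_zero_of_forall_exists_norm_lt fun ε hε => ?_)⟩
  obtain ⟨d, hd, hd'⟩ := h ε hε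
  exact ⟨d - s, sub_le_sub_right (hu hd) s, hd'⟩

theorem norm_le_norm_of_nonneg_of_le {x y : E} (hx : 0 ≤ x) (hxy : x ≤ y) : ‖x‖ ≤ ‖y‖ :=
  norm_le_norm_of_abs_le_abs (by rwa [abs_of_nonneg hx, abs_of_nonneg (hx.trans hxy)])

variable [NormedSpace ℝ E]

/-- Order continuity is applied to the decreasing set `s - D`, whose infimum is `0`. -/
theorem exists_norm_sub_lt_of_isLUB (hE : IsOrderContinuousNorm E (fun e => ‖e‖)) {D : Set E}
    (hne : D.Nonempty) (hdir : DirectedOn (· ≤ ·) D) {s : E} (hs : IsLUB D s) {ε : ℝ}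
    (hε : 0 < ε) : ∃ d ∈ D, ∀ d' ∈ D, d ≤ d' → ‖s - d'‖ < ε := by
  obtain ⟨_, ⟨d, hd, rfl⟩, h⟩ := hE ((fun d => s - d) '' D) (hne.image _) (by
    rintro _ ⟨a, ha, rfl⟩ _ ⟨b, hb, rfl⟩
    obtain ⟨c, hc, hac, hbc⟩ := hdir a ha b hb
    exact ⟨s - c, ⟨c, hc, rfl⟩, sub_le_sub_left hac s, sub_le_sub_left hbc s⟩) (by
    refine ⟨?_, fun u hu => ?_⟩
    · rintro _ ⟨a, ha, rfl⟩
      exact sub_nonneg.2 (hs.1 ha)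
    · have : s ≤ s - u := hs.2 fun a ha => le_sub_comm.1 (hu ⟨a, ha, rfl⟩)
      simpa using this) ε hε
  exact ⟨d, hd, fun d' hd' hdd => (norm_le_norm_of_nonneg_of_le (sub_nonneg.2 (hs.1 hd'))
    (sub_le_sub_left hdd s)).trans_lt h⟩

theorem exists_norm_sub_lt_of_isGLB (hE : IsOrderContinuousNorm E (fun e => ‖e‖)) {D : Set E}
    (hne : D.Nonempty) (hdir : DirectedOn (· ≥ ·) D) {s : E} (hs : IsGLB D s) {ε : ℝ}
    (hε : 0 < ε) : ∃ d ∈ D, ‖d - s‖ < ε := by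
  obtain ⟨_, ⟨d, hd, rfl⟩, h⟩ := hE ((fun d => d - s) '' D) (hne.image _) (by
    rintro _ ⟨a, ha, rfl⟩ _ ⟨b, hb, rfl⟩
    obtain ⟨c, hc, hac, hbc⟩ := hdir a ha b hb
    exact ⟨c - s, ⟨c, hc, rfl⟩, sub_le_sub_right hac s, sub_le_sub_right hbc s⟩) (by
    refine ⟨?_, fun u hu => ?_⟩
    · rintro _ ⟨a, ha, rfl⟩
      exact sub_nonneg.2 (hs.1 ha)
    · have : u + s ≤ s := hs.2 fun a ha => le_sub_iff_add_le.1 (hu ⟨a, ha, rfl⟩)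
      simpa using this) ε hε
  exact ⟨d, hd, h⟩

/-- The supremum of a bounded increasing sequence is its norm limit. -/
theorem tendsto_of_isLUB_range (hE : IsOrderContinuousNorm E (fun e => ‖e‖)) {a : ℕ → E}
    (ha : Monotone a) {s : E} (hs : IsLUB (range a) s) : Tendsto a atTop (𝓝 s) := by
  rw [Metric.tendsto_atTop]
  intro ε hε
  obtain ⟨_, ⟨n, rfl⟩, h⟩ := exists_norm_sub_lt_of_isLUB hE (range_nonempty a)
    (directedOn_range.2 (ha.directed_le)) hs hε
  exact ⟨n, fun m hm => by
    rw [dist_comm, dist_eq_norm]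
    exact h _ ⟨m, rfl⟩ (ha hm)⟩

/-- A monotone continuous functional preserves suprema of directed sets. -/
theorem isLUB_image_of_directedOn (hE : IsOrderContinuousNorm E (fun e => ‖e‖)) {D : Set E}
    (hne : D.Nonempty) (hdir : DirectedOn (· ≤ ·) D) {s : E} (hs : IsLUB D s)
    {φ : E →L[ℝ] ℝ} (hφ : Monotone φ) : IsLUB (φ '' D) (φ s) := by
  refine ⟨?_, fun u hu => le_of_forall_pos_lt_add fun ε hε => ?_⟩
  · rintro _ ⟨d, hd, rfl⟩
    exact hφ (hs.1 hd)
  · obtain ⟨δ, hδ, h⟩ := Metric.continuousAt_iff.1 (φ.continuous.continuousAt (x := s)) ε hε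
    obtain ⟨d, hd, hd'⟩ := exists_norm_sub_lt_of_isLUB hE hne hdir hs hδ
    have h1 := h (x := d) (by rw [dist_comm, dist_eq_norm]; exact hd' d hd le_rfl)
    have h2 : φ d ≤ u := hu ⟨d, hd, rfl⟩
    rw [Real.dist_eq, abs_lt] at h1
    linarith

theorem isGLB_image_of_directedOn (hE : IsOrderContinuousNorm E (fun e => ‖e‖)) {D : Set E}
    (hne : D.Nonempty) (hdir : DirectedOn (· ≥ ·) D) {s : E} (hs : IsGLB D s)
    {φ : E →L[ℝ] ℝ} (hφ : Monotone φ) : IsGLB (φ '' D) (φ s) := by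
  refine ⟨?_, fun u hu => le_of_forall_pos_lt_add fun ε hε => ?_⟩
  · rintro _ ⟨d, hd, rfl⟩
    exact hφ (hs.1 hd)
  · obtain ⟨δ, hδ, h⟩ := Metric.continuousAt_iff.1 (φ.continuous.continuousAt (x := s)) ε hε
    obtain ⟨d, hd, hd'⟩ := exists_norm_sub_lt_of_isGLB hE hne hdir hs hδ
    have h1 := h (x := d) (by rw [dist_eq_norm]; exact hd')
    have h2 : u ≤ φ d := hu ⟨d, hd, rfl⟩
    rw [Real.dist_eq, abs_lt] at h1
    linarith

variable [IsOrderedModule ℝ E]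

/-- The order is determined by the monotone continuous functionals. -/
theorem le_of_forall_monotone {x y : E}
    (h : ∀ φ : E →L[ℝ] ℝ, Monotone φ → φ x ≤ φ y) : x ≤ y := by
  by_contra hxy
  -- Separate `y - x` from the closed positive cone. A functional bounded above on a cone is
  -- nonpositive there, so `-f` is monotone and contradicts the hypothesis.
  obtain ⟨f, u, hf, hu⟩ := geometric_hahn_banach_closed_point (convex_Ici (𝕜 := ℝ) (0 : E))
    isClosed_Ici (show y - x ∉ Ici (0 : E) by simpa using hxy)
  have hu0 : 0 < u := by simpa using hf 0 (mem_Ici.2 le_rfl)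
  have hneg : ∀ a : E, 0 ≤ a → f a ≤ 0 := by
    intro a ha
    by_contra! hpos
    -- This multiple of `a` lies in the cone and `f` takes the forbidden value `u` on it.
    have := hf ((u / f a) • a) (mem_Ici.2 (smul_nonneg (by positivity) ha))
    rw [map_smul, smul_eq_mul, div_mul_cancel₀ _ hpos.ne'] at this
    exact lt_irrefl _ this
  have := h (-f) fun a b hab => by
    have := hneg (b - a) (sub_nonneg.2 hab)
    simp only [map_sub] at this
    simpa using this
  simp only [neg_apply, map_sub] at this hu
  linarith

theorem eq_of_forall_monotone {x y : E}
    (h : ∀ φ : E →L[ℝ] ℝ, Monotone φ → φ x = φ y) : x = y :=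
  le_antisymm (le_of_forall_monotone fun φ hφ => (h φ hφ).le)
    (le_of_forall_monotone fun φ hφ => (h φ hφ).ge)

variable [CompleteSpace E]

/-- The differences `u - d` of upper bounds and elements of `D` form a downward directed set with
infimum `0`. By order continuity some are small in norm, which makes `D` a Cauchy net; its limit is
the supremum. -/
theorem exists_isLUB_of_directedOn (hE : IsOrderContinuousNorm E (fun e => ‖e‖)) {D : Set E}
    (hne : D.Nonempty) (hdir : DirectedOn (· ≤ ·) D) (hbdd : BddAbove D) : ∃ s, IsLUB D s := by
  have hcauchy : ∀ ε > 0, ∃ d ∈ D, ∀ d' ∈ D, d ≤ d' → ‖d' - d‖ < ε := by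
    intro ε hε
    obtain ⟨_, ⟨u, hu, d, hd, rfl⟩, h⟩ :=
      hE {x | ∃ u ∈ upperBounds D, ∃ d ∈ D, u - d = x} (by
        obtain ⟨u, hu⟩ := hbdd
        obtain ⟨d, hd⟩ := hne
        exact ⟨_, u, hu, d, hd, rfl⟩) (by
        rintro _ ⟨u, hu, a, ha, rfl⟩ _ ⟨v, hv, b, hb, rfl⟩
        obtain ⟨c, hc, hac, hbc⟩ := hdir a ha b hb
        exact ⟨u ⊓ v - c, ⟨_, fun d hd => le_inf (hu hd) (hv hd), c, hc, rfl⟩,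
          sub_le_sub inf_le_left hac, sub_le_sub inf_le_right hbc⟩) (by
        refine ⟨?_, fun z hz => ?_⟩
        · rintro _ ⟨u, hu, a, ha, rfl⟩
          exact sub_nonneg.2 (hu ha)
        · obtain ⟨u, hu⟩ := hbdd
          obtain ⟨d, hd⟩ := hne
          -- Subtracting a lower bound `z` of the differences from an upper bound of `D` yields
          -- another upper bound. Iterating gives `z ≤ (u - d) / n` for all `n`, hence `z ≤ 0`.
          have key : ∀ n : ℕ, u - (n : ℝ) • z ∈ upperBounds D := by
            intro n
            induction n with
            | zero => simpa using hu
            | succ n ih =>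
              intro a ha
              have := hz ⟨_, ih, a, ha, rfl⟩
              push_cast
              rw [add_smul, one_smul, ← sub_sub]
              exact le_sub_comm.1 this
          refine le_zero_of_forall_exists_norm_lt fun ε hε => ?_
          obtain ⟨n, hn⟩ := exists_nat_gt (‖u - d‖ / ε)
          have hn0 : (0 : ℝ) < n := lt_of_le_of_lt (by positivity) hn
          refine ⟨(n : ℝ)⁻¹ • (u - d), ?_, ?_⟩
          · have h1 : (n : ℝ) • z ≤ u - d := le_sub_comm.1 (key n hd)
            have := smul_le_smul_of_nonneg_left h1 (inv_nonneg.2 hn0.le)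
            rwa [smul_smul, inv_mul_cancel₀ hn0.ne', one_smul] at this
          · rw [norm_smul, norm_inv, Real.norm_of_nonneg hn0.le, inv_mul_lt_iff₀ hn0]
            rwa [div_lt_iff₀ hε] at hn) ε hε
    exact ⟨d, hd, fun d' hd' hdd => (norm_le_norm_of_nonneg_of_le (sub_nonneg.2 hdd)
      (sub_le_sub_right (hu hd') d)).trans_lt h⟩
  have : Nonempty D := hne.to_subtype
  have : IsDirectedOrder D := directedOn_iff_isDirectedOrder.1 hdir
  have hC : CauchySeq (fun d : D => (d : E)) := by
    refine Metric.cauchy_iff.2 ⟨inferInstance, fun ε hε => ?_⟩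
    obtain ⟨d, hd, h⟩ := hcauchy (ε / 2) (half_pos hε)
    refine ⟨_, image_mem_map (Ici_mem_atTop (⟨d, hd⟩ : D)), ?_⟩
    rintro _ ⟨a, ha, rfl⟩ _ ⟨b, hb, rfl⟩
    refine (dist_triangle_right _ _ d).trans_lt ?_
    rw [dist_eq_norm, dist_eq_norm]
    linarith [h a a.2 ha, h b b.2 hb]
  obtain ⟨s, hs⟩ := cauchySeq_tendsto_of_complete hC
  refine ⟨s, fun d hd => ?_, fun u hu => ?_⟩
  · exact ge_of_tendsto hs (eventually_ge_atTop (⟨d, hd⟩ : D))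
  · exact le_of_tendsto hs (Eventually.of_forall fun d => hu d.2)

/-- A Banach lattice with order continuous norm is Dedekind complete. -/
theorem exists_isLUB_of_bddAbove (hE : IsOrderContinuousNorm E (fun e => ‖e‖)) {S : Set E}
    (hne : S.Nonempty) (hbdd : BddAbove S) : ∃ s, IsLUB S s := by
  classical
  -- Suprema of finite non-empty subsets of `S` form a directed set with the same upper bounds as
  -- `S`.
  obtain ⟨s, hs⟩ := exists_isLUB_of_directedOn hE
    (D := {a | ∃ t : Finset E, ↑t ⊆ S ∧ ∃ h : t.Nonempty, t.sup' h id = a}) (by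
      obtain ⟨x, hx⟩ := hne
      exact ⟨x, {x}, by simpa using hx, by simp, by simp⟩) (by
      rintro _ ⟨t, ht, h, rfl⟩ _ ⟨t', ht', h', rfl⟩
      exact ⟨_, ⟨t ∪ t', by simp [ht, ht'], h.mono Finset.subset_union_left, rfl⟩,
        Finset.sup'_mono _ Finset.subset_union_left h,
        Finset.sup'_mono _ Finset.subset_union_right h'⟩) (by
      obtain ⟨u, hu⟩ := hbdd
      refine ⟨u, ?_⟩
      rintro _ ⟨t, ht, h, rfl⟩
      exact Finset.sup'_le _ _ fun x hx => hu (ht hx))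
  refine ⟨s, fun x hx => hs.1 ⟨{x}, by simpa using hx, by simp, by simp⟩, fun u hu => hs.2 ?_⟩
  rintro _ ⟨t, ht, h, rfl⟩
  exact Finset.sup'_le _ _ fun x hx => hu (ht hx)

end OrderContinuity

/-! ### Finitely additive set functions, σ-additivity and regularity in norm. -/

section Contents

variable {X : Type*} [MeasurableSpace X]
variable {E : Type*} [NormedAddCommGroup E] [Lattice E]

/-- Finitely additive set functions with values in the positive cone. -/
structure IsContent (ν : MSet X → E) : Prop where
  nonneg : ∀ A, 0 ≤ ν A
  union : ∀ A B : MSet X, Disjoint A.1 B.1 → ν (A ∪ B) = ν A + ν B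

namespace IsContent

variable {ν ξ : MSet X → E}

theorem empty (h : IsContent ν) : ν ∅ = 0 := by
  have := h.union ∅ ∅ (by simp)
  rwa [show (∅ ∪ ∅ : MSet X) = ∅ from Subtype.ext (by simp), left_eq_add] at this

theorem add_diff (h : IsContent ν) {A B : MSet X} (hAB : A.1 ⊆ B.1) :
    ν A + ν (B \ A) = ν B := by
  rw [← h.union A (B \ A) (by simpa using disjoint_sdiff_right)]
  exact congrArg ν (Subtype.ext (by simpa using hAB))

theorem diff (h : IsContent ν) {A B : MSet X} (hAB : A.1 ⊆ B.1) : ν (B \ A) = ν B - ν A := by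
  rw [← h.add_diff hAB, add_sub_cancel_left]

theorem sum_range (h : IsContent ν) {A : ℕ → MSet X}
    (hA : ∀ i j, i ≠ j → Disjoint (A i).1 (A j).1) {U : MSet X} (hU : U.1 = ⋃ i, (A i).1) (n : ℕ) :
    ∃ B : MSet X, B.1 = U.1 \ (⋃ i, ⋃ (_ : i < n), (A i).1) ∧
      ∑ i ∈ Finset.range n, ν (A i) + ν B = ν U := by
  induction n with
  | zero => exact ⟨U, by simp, by simp⟩
  | succ n ih =>
    obtain ⟨B, hB, hs⟩ := ih
    refine ⟨B \ A n, ?_, ?_⟩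
    · rw [MeasurableSet.coe_sdiff, hB]
      ext x
      simp only [Set.mem_sdiff, mem_iUnion, not_exists, exists_prop, Nat.lt_succ_iff_lt_or_eq]
      grind
    · have hsub : (A n).1 ⊆ B.1 := by
        rw [hB, hU]
        intro x hx
        refine ⟨mem_iUnion.2 ⟨n, hx⟩, ?_⟩
        simp only [mem_iUnion, not_exists]
        intro i hi hxi
        exact (hA i n hi.ne).le_bot ⟨hxi, hx⟩
      rw [Finset.sum_range_succ, add_assoc, h.add_diff hsub, hs]

variable [IsOrderedAddMonoid E]

theorem mono (h : IsContent ν) {A B : MSet X} (hAB : A.1 ⊆ B.1) : ν A ≤ ν B := by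
  rw [← h.add_diff hAB]
  exact le_add_of_nonneg_right (h.nonneg _)

theorem sub (h : IsContent ν) (k : IsContent ξ) (hle : ξ ≤ ν) : IsContent (ν - ξ) where
  nonneg A := sub_nonneg.2 (hle A)
  union A B hAB := by
    simp only [Pi.sub_apply, h.union A B hAB, k.union A B hAB]
    abel

variable [HasSolidNorm E]

theorem norm_mono (h : IsContent ν) {A B : MSet X} (hAB : A.1 ⊆ B.1) : ‖ν A‖ ≤ ‖ν B‖ :=
  norm_le_norm_of_nonneg_of_le (h.nonneg A) (h.mono hAB)

/-- A content that is continuous at `∅` in norm is a measure. -/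
theorem isPosMeasure (h : IsContent ν)
    (hν : ∀ B : ℕ → MSet X, Antitone (fun n => (B n).1) → ⋂ n, (B n).1 = ∅ →
      ∀ ε > 0, ∃ n, ‖ν (B n)‖ < ε) : IsPosMeasure ν where
  nonneg := h.nonneg
  empty := h.empty
  iUnion A hA := by
    set U : MSet X := ⟨⋃ i, (A i).1, MeasurableSet.iUnion fun i => (A i).2⟩ with hU
    choose B hB hs using fun n => h.sum_range hA (U := U) rfl n
    refine isLUB_of_forall_exists_norm_sub_lt ?_ fun ε hε => ?_
    · rintro _ ⟨n, rfl⟩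
      rw [← hs n]
      exact le_add_of_nonneg_right (h.nonneg _)
    -- The remainders `B n = U \ ⋃ i < n, A i` decrease to `∅`, and `ν (B n)` is the error of the
    -- `n`-th partial sum.
    · obtain ⟨n, hn⟩ := hν B (by
        intro m n hmn
        simp only [hB]
        refine sdiff_subset_sdiff_right (iUnion_mono fun i => ?_)
        exact iUnion_mono' fun hi => ⟨hi.trans_le hmn, Subset.rfl⟩) (by
        simp only [hB]
        refine eq_empty_iff_forall_notMem.2 fun x hx => ?_
        have h0 := mem_iInter.1 hx
        obtain ⟨i, hi⟩ := mem_iUnion.1 (show x ∈ ⋃ i, (A i).1 from (h0 0).1)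
        exact (h0 (i + 1)).2 (mem_iUnion₂.2 ⟨i, Nat.lt_succ_self i, hi⟩)) ε hε
      exact ⟨_, ⟨n, rfl⟩, by rwa [← hs n, add_sub_cancel_left]⟩

end IsContent

variable [IsOrderedAddMonoid E] [HasSolidNorm E] [NormedSpace ℝ E] {ν ξ : MSet X → E}

/-- Pad `A, B` with empty sets. The partial sums are constant from the second on, so their supremum
is this greatest value. -/
theorem IsPosMeasure.isContent (h : IsPosMeasure ν) : IsContent ν where
  nonneg := h.nonneg
  union A B hAB := by
    have h0 : ν ∅ = 0 := h.empty
    let S : ℕ → MSet X := fun n => if n = 0 then A else if n = 1 then B else ∅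
    have hsum : ∀ n, ∑ i ∈ Finset.range (n + 2), ν (S i) = ν A + ν B := by
      intro n
      induction n with
      | zero => simp [S, Finset.sum_range_succ]
      | succ n ih =>
        rw [Finset.sum_range_succ, ih]
        simp [S, h0]
    have hlub := h.iUnion S (by
      intro i j hij
      simp only [S]
      split_ifs <;> first | omega | exact hAB | exact hAB.symm | simp)
    have hU : (⟨⋃ i, (S i).1, MeasurableSet.iUnion fun i => (S i).2⟩ : MSet X) = A ∪ B := by
      refine Subtype.ext ?_
      ext x
      simp only [mem_iUnion, MeasurableSet.coe_union, mem_union]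
      constructor
      · rintro ⟨i, hi⟩
        simp only [S] at hi
        split_ifs at hi
        · exact .inl hi
        · exact .inr hi
        · exact absurd hi (by simp)
      · rintro (hx | hx)
        · exact ⟨0, by simpa [S] using hx⟩
        · exact ⟨1, by simpa [S] using hx⟩
    rw [hU] at hlub
    have hgr : IsGreatest (range fun n : ℕ => ∑ i ∈ Finset.range n, ν (S i)) (ν A + ν B) := by
      refine ⟨⟨2, hsum 0⟩, ?_⟩
      rintro _ ⟨n, rfl⟩
      rw [← hsum n]
      exact h.monotone_sum S (by omega)
    exact hlub.unique hgr.isLUB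

/-- Since the intersection is empty, `B 0` is the disjoint union of the layers `B i \ B (i + 1)`.
The partial sums telescope to `ν (B 0) - ν (B n)` and tend to `ν (B 0)` in norm. -/
theorem IsPosMeasure.exists_norm_lt (hE : IsOrderContinuousNorm E (fun e => ‖e‖))
    (h : IsPosMeasure ν) {B : ℕ → MSet X} (hB : Antitone (fun n => (B n).1))
    (hB0 : ⋂ n, (B n).1 = ∅) {ε : ℝ} (hε : 0 < ε) : ∃ n, ‖ν (B n)‖ < ε := by
  have hsub : ∀ n, (B (n + 1)).1 ⊆ (B n).1 := fun n => hB n.le_succ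
  have hlub := h.iUnion (fun n => B n \ B (n + 1)) (by
    have key : ∀ i j, i < j → Disjoint (B i \ B (i + 1)).1 (B j \ B (j + 1)).1 := by
      intro i j hij
      simp only [MeasurableSet.coe_sdiff]
      exact (disjoint_sdiff_left.mono_right (hB (show i + 1 ≤ j from hij))).mono_right sdiff_subset
    intro i j hij
    obtain hlt | hlt := lt_or_gt_of_ne hij
    · exact key i j hlt
    · exact (key j i hlt).symm)
  have hU : (⟨⋃ i, (B i \ B (i + 1)).1, MeasurableSet.iUnion fun i => (B i \ B (i + 1)).2⟩ : MSet X)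
      = B 0 := by
    refine Subtype.ext (subset_antisymm (iUnion_subset fun i => ?_) fun x hx => ?_)
    · simp only [MeasurableSet.coe_sdiff]
      exact sdiff_subset.trans (hB i.zero_le)
    · by_contra hne
      simp only [MeasurableSet.coe_sdiff, mem_iUnion, Set.mem_sdiff, not_exists, not_and, not_not] at hne
      have : ∀ n, x ∈ (B n).1 := fun n => by
        induction n with
        | zero => exact hx
        | succ n ih => exact hne n ih
      exact (hB0 ▸ mem_iInter.2 this : x ∈ (∅ : Set X))
  have hsum : ∀ n, ∑ i ∈ Finset.range n, ν (B i \ B (i + 1)) = ν (B 0) - ν (B n) := by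
    intro n
    simp only [h.isContent.diff (hsub _)]
    exact Finset.sum_range_sub' (fun i => ν (B i)) n
  have ht := tendsto_of_isLUB_range hE (h.monotone_sum _) hlub
  rw [hU] at ht
  simp only [hsum] at ht
  obtain ⟨n, hn⟩ := Metric.tendsto_atTop.1 ht ε hε
  refine ⟨n, ?_⟩
  have := hn n le_rfl
  rwa [dist_comm, dist_eq_norm, sub_sub_cancel] at this

/-- A content that is dominated up to `ε` by measures is a measure. -/
theorem IsContent.isPosMeasure_of_norm_le (hE : IsOrderContinuousNorm E (fun e => ‖e‖))
    (h : IsContent ν) (hν : ∀ ε > 0, ∃ ξ : MSet X → E, IsPosMeasure ξ ∧ ∀ A, ‖ν A‖ ≤ ‖ξ A‖ + ε) :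
    IsPosMeasure ν :=
  h.isPosMeasure fun B hB hB0 ε hε => by
    obtain ⟨ξ, hξ, hle⟩ := hν (ε / 2) (half_pos hε)
    obtain ⟨n, hn⟩ := hξ.exists_norm_lt hE hB hB0 (half_pos hε)
    exact ⟨n, by linarith [hle (B n)]⟩

variable [TopologicalSpace X]

/-- A measure is regular if it satisfies the regularity conditions in norm. -/
theorem IsPosMeasure.isPosRegularMeasure (h : IsPosMeasure ν)
    (hi : ∀ V : MSet X, IsOpen V.1 → ∀ ε > 0, ∃ K : MSet X, IsCompact K.1 ∧ K.1 ⊆ V.1 ∧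
      ‖ν (V \ K)‖ < ε)
    (ho : ∀ A : MSet X, ∀ ε > 0, ∃ V : MSet X, IsOpen V.1 ∧ A.1 ⊆ V.1 ∧ ‖ν (V \ A)‖ < ε) :
    IsPosRegularMeasure ν where
  toIsPosMeasure := h
  innerRegular V hV := by
    refine isLUB_of_forall_exists_norm_sub_lt ?_ fun ε hε => ?_
    · rintro _ ⟨K, -, hKV, rfl⟩
      exact h.isContent.mono hKV
    · obtain ⟨K, hK, hKV, hlt⟩ := hi V hV ε hε
      exact ⟨_, ⟨K, hK, hKV, rfl⟩, by rwa [← h.isContent.diff hKV]⟩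
  outerRegular A := by
    refine isGLB_of_forall_exists_norm_sub_lt ?_ fun ε hε => ?_
    · rintro _ ⟨V, -, hAV, rfl⟩
      exact h.isContent.mono hAV
    · obtain ⟨V, hV, hAV, hlt⟩ := ho A ε hε
      exact ⟨_, ⟨V, hV, hAV, rfl⟩, by rwa [← h.isContent.diff hAV]⟩

/-- Open supersets are closed under intersection, so the infimum in the definition is over a
directed set and becomes a norm limit. -/
theorem IsPosRegularMeasure.exists_isOpen (hE : IsOrderContinuousNorm E (fun e => ‖e‖))
    (h : IsPosRegularMeasure ν) (A : MSet X) {ε : ℝ} (hε : 0 < ε) :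
    ∃ V : MSet X, IsOpen V.1 ∧ A.1 ⊆ V.1 ∧ ‖ν (V \ A)‖ < ε := by
  have hc := h.toIsPosMeasure.isContent
  obtain ⟨_, ⟨V, hV, hAV, rfl⟩, hlt⟩ := exists_norm_sub_lt_of_isGLB hE
    (D := {e | ∃ V : MSet X, IsOpen V.1 ∧ A.1 ⊆ V.1 ∧ ν V = e})
    ⟨_, ⊤, isOpen_univ, subset_univ _, rfl⟩ (by
      rintro _ ⟨V, hV, hAV, rfl⟩ _ ⟨W, hW, hAW, rfl⟩
      exact ⟨_, ⟨V ∩ W, by simpa using hV.inter hW, by simpa using ⟨hAV, hAW⟩, rfl⟩,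
        hc.mono (by simp), hc.mono (by simp)⟩) (h.outerRegular A) hε
  exact ⟨V, hV, hAV, by rwa [hc.diff hAV]⟩

variable [T2Space X] [BorelSpace X]

theorem IsPosRegularMeasure.exists_isCompact (hE : IsOrderContinuousNorm E (fun e => ‖e‖))
    (h : IsPosRegularMeasure ν) {V : MSet X} (hV : IsOpen V.1) {ε : ℝ} (hε : 0 < ε) :
    ∃ K : MSet X, IsCompact K.1 ∧ K.1 ⊆ V.1 ∧ ‖ν (V \ K)‖ < ε := by
  have hc := h.toIsPosMeasure.isContent
  obtain ⟨_, ⟨K, hK, hKV, rfl⟩, hlt⟩ := exists_norm_sub_lt_of_isLUB hE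
    (D := {e | ∃ K : MSet X, IsCompact K.1 ∧ K.1 ⊆ V.1 ∧ ν K = e})
    ⟨_, ∅, by simp, by simp, rfl⟩ (by
      rintro _ ⟨K, hK, hKV, rfl⟩ _ ⟨L, hL, hLV, rfl⟩
      exact ⟨_, ⟨K ∪ L, by simpa using hK.union hL, by simpa using ⟨hKV, hLV⟩, rfl⟩,
        hc.mono (by simp), hc.mono (by simp)⟩) (h.innerRegular V hV) hε
  exact ⟨K, hK, hKV, by rw [hc.diff hKV]; exact hlt _ ⟨K, hK, hKV, rfl⟩ le_rfl⟩

/-- A content that is dominated up to `ε` by regular measures is a regular measure. -/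
theorem IsContent.isPosRegularMeasure_of_norm_le (hE : IsOrderContinuousNorm E (fun e => ‖e‖))
    (h : IsContent ν)
    (hν : ∀ ε > 0, ∃ ξ : MSet X → E, IsPosRegularMeasure ξ ∧ ∀ A, ‖ν A‖ ≤ ‖ξ A‖ + ε) :
    IsPosRegularMeasure ν := by
  refine (h.isPosMeasure_of_norm_le hE fun ε hε => ?_).isPosRegularMeasure ?_ ?_
  · obtain ⟨ξ, hξ, hle⟩ := hν ε hε
    exact ⟨ξ, hξ.toIsPosMeasure, hle⟩
  · intro V hV ε hε
    obtain ⟨ξ, hξ, hle⟩ := hν (ε / 2) (half_pos hε)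
    obtain ⟨K, hK, hKV, hlt⟩ := hξ.exists_isCompact hE hV (half_pos hε)
    exact ⟨K, hK, hKV, by linarith [hle (V \ K)]⟩
  · intro A ε hε
    obtain ⟨ξ, hξ, hle⟩ := hν (ε / 2) (half_pos hε)
    obtain ⟨V, hV, hAV, hlt⟩ := hξ.exists_isOpen hE A (half_pos hε)
    exact ⟨V, hV, hAV, by linarith [hle (V \ A)]⟩

theorem IsContent.isPosRegularMeasure_of_le (hE : IsOrderContinuousNorm E (fun e => ‖e‖))
    (h : IsContent ν) (hξ : IsPosRegularMeasure ξ) (hle : ν ≤ ξ) : IsPosRegularMeasure ν :=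
  h.isPosRegularMeasure_of_norm_le hE fun _ hε => ⟨ξ, hξ, fun A =>
    (norm_le_norm_of_nonneg_of_le (h.nonneg A) (hle A)).trans (le_add_of_nonneg_right hε.le)⟩

theorem IsPosRegularMeasure.add (hE : IsOrderContinuousNorm E (fun e => ‖e‖))
    (h : IsPosRegularMeasure ν) (k : IsPosRegularMeasure ξ) : IsPosRegularMeasure (ν + ξ) := by
  have hc := h.toIsPosMeasure.isContent
  have kc := k.toIsPosMeasure.isContent
  refine (h.toIsPosMeasure.add k.toIsPosMeasure).isPosRegularMeasure ?_ ?_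
  · intro V hV ε hε
    obtain ⟨K, hK, hKV, hlt⟩ := h.exists_isCompact hE hV (half_pos hε)
    obtain ⟨L, hL, hLV, hlt'⟩ := k.exists_isCompact hE hV (half_pos hε)
    refine ⟨K ∪ L, by simpa using hK.union hL, by simpa using ⟨hKV, hLV⟩, ?_⟩
    have h1 := hc.norm_mono (A := V \ (K ∪ L)) (B := V \ K)
      (by simpa using sdiff_subset_sdiff_right subset_union_left)
    have h2 := kc.norm_mono (A := V \ (K ∪ L)) (B := V \ L)
      (by simpa using sdiff_subset_sdiff_right subset_union_right)
    refine (norm_add_le _ _).trans_lt ?_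
    linarith
  · intro A ε hε
    obtain ⟨V, hV, hAV, hlt⟩ := h.exists_isOpen hE A (half_pos hε)
    obtain ⟨W, hW, hAW, hlt'⟩ := k.exists_isOpen hE A (half_pos hε)
    refine ⟨V ∩ W, by simpa using hV.inter hW, by simpa using ⟨hAV, hAW⟩, ?_⟩
    have h1 := hc.norm_mono (A := (V ∩ W) \ A) (B := V \ A)
      (by simpa using sdiff_subset_sdiff_left inter_subset_left)
    have h2 := kc.norm_mono (A := (V ∩ W) \ A) (B := W \ A)
      (by simpa using sdiff_subset_sdiff_left inter_subset_right)
    refine (norm_add_le _ _).trans_lt ?_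
    linarith

theorem IsPosRegularMeasure.zero : IsPosRegularMeasure (0 : MSet X → E) :=
  IsPosMeasure.zero.isPosRegularMeasure (fun _ _ ε hε => ⟨∅, by simp, by simp, by simpa using hε⟩)
    fun _ ε hε => ⟨⊤, isOpen_univ, subset_univ _, by simpa using hε⟩

theorem IsPosRegularMeasure.smul [IsOrderedModule ℝ E]
    (hE : IsOrderContinuousNorm E (fun e => ‖e‖))
    (h : IsPosRegularMeasure ν) {r : ℝ} (hr : 0 ≤ r) : IsPosRegularMeasure (r • ν) := by
  -- Dividing by `r + 1` instead of `r` covers `r = 0`.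
  have hlt : ∀ {A : MSet X} {ε : ℝ}, ‖ν A‖ < ε / (r + 1) → ‖(r • ν) A‖ < ε := by
    intro A ε hA
    rw [lt_div_iff₀ (by linarith)] at hA
    rw [Pi.smul_apply, norm_smul, Real.norm_of_nonneg hr]
    nlinarith [norm_nonneg (ν A)]
  refine (h.toIsPosMeasure.smul hr).isPosRegularMeasure ?_ ?_
  · intro V hV ε hε
    obtain ⟨K, hK, hKV, h1⟩ := h.exists_isCompact hE hV (show 0 < ε / (r + 1) by positivity)
    exact ⟨K, hK, hKV, hlt h1⟩
  · intro A ε hε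
    obtain ⟨V, hV, hAV, h1⟩ := h.exists_isOpen hE A (show 0 < ε / (r + 1) by positivity)
    exact ⟨V, hV, hAV, hlt h1⟩

/-- Every regular measure is a difference of two positive regular measures. -/
theorem exists_regular_decomposition [IsOrderedModule ℝ E]
    (hE : IsOrderContinuousNorm E (fun e => ‖e‖)) {μ : MSet X → E}
    (hμ : μ ∈ regularMeasures X E) :
    ∃ ν₁ ν₂ : MSet X → E, IsPosRegularMeasure ν₁ ∧ IsPosRegularMeasure ν₂ ∧ μ = ν₁ - ν₂ := by
  induction hμ using Submodule.span_induction with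
  | mem x h => exact ⟨x, 0, h, .zero, by simp⟩
  | zero => exact ⟨0, 0, .zero, .zero, by simp⟩
  | add x y _ _ hx hy =>
    obtain ⟨ν₁, ν₂, h1, h2, rfl⟩ := hx
    obtain ⟨ξ₁, ξ₂, k1, k2, rfl⟩ := hy
    exact ⟨_, _, h1.add hE k1, h2.add hE k2, by abel⟩
  | smul r x _ hx =>
    obtain ⟨ν₁, ν₂, h1, h2, rfl⟩ := hx
    obtain hr | hr := le_total 0 r
    · exact ⟨_, _, h1.smul hE hr, h2.smul hE hr, smul_sub _ _ _⟩
    · refine ⟨_, _, h2.smul hE (neg_nonneg.2 hr), h1.smul hE (neg_nonneg.2 hr), ?_⟩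
      simp only [smul_sub, neg_smul]
      abel

/-- The point mass at `x` with value `e`. -/
noncomputable def pointMass (x : X) (e : E) (A : MSet X) : E :=
  A.1.indicator (fun _ => e) x

theorem isPosRegularMeasure_pointMass (x : X) {e : E} (he : 0 ≤ e) :
    IsPosRegularMeasure (pointMass x e) := by
  have hout : ∀ {A : MSet X}, x ∉ A.1 → pointMass x e A = 0 := fun h => indicator_of_notMem h _
  have hc : IsContent (pointMass (X := X) x e) := by
    refine ⟨fun A => indicator_nonneg (fun _ _ => he) x, fun A B hAB => ?_⟩
    exact congrFun (indicator_union_of_disjoint hAB (fun _ => e)) x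
  refine (hc.isPosMeasure fun B _ hB0 ε hε => ?_).isPosRegularMeasure ?_ ?_
  · have : x ∉ ⋂ n, (B n).1 := by simp [hB0]
    obtain ⟨n, hn⟩ := not_forall.1 (mem_iInter.not.1 this)
    exact ⟨n, by rwa [hout hn, norm_zero]⟩
  · intro V _ ε hε
    by_cases hx : x ∈ V.1
    · exact ⟨⟨{x}, measurableSet_singleton x⟩, isCompact_singleton, by simpa using hx, by
        rwa [hout (by simp), norm_zero]⟩
    · exact ⟨∅, by simp, by simp, by rwa [hout (by simpa using hx), norm_zero]⟩
  · intro A ε hε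
    by_cases hx : x ∈ A.1
    · exact ⟨⊤, isOpen_univ, subset_univ _, by rwa [hout (by simpa using hx), norm_zero]⟩
    · exact ⟨⟨{x}ᶜ, (measurableSet_singleton x).compl⟩, isOpen_compl_singleton,
        by simpa using hx, by rwa [hout (by simp), norm_zero]⟩

end Contents

/-! ### The order integral, computed through scalar measures. -/

open MeasureTheory
open scoped Pointwise

/-- Bounded measurable functions. -/
structure IsBoundedMeasurable {X : Type*} [MeasurableSpace X] (f : X → ℝ) : Prop where
  measurable : Measurable f
  bounded : ∃ c : ℝ, ∀ x, |f x| ≤ c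

namespace IsBoundedMeasurable

variable {X : Type*} [MeasurableSpace X] {f g : X → ℝ}

theorem add (hf : IsBoundedMeasurable f) (hg : IsBoundedMeasurable g) :
    IsBoundedMeasurable (fun x => f x + g x) := by
  obtain ⟨c, hc⟩ := hf.bounded
  obtain ⟨d, hd⟩ := hg.bounded
  exact ⟨hf.measurable.add hg.measurable, c + d, fun x =>
    (abs_add_le _ _).trans (add_le_add (hc x) (hd x))⟩

theorem smul (hf : IsBoundedMeasurable f) (r : ℝ) : IsBoundedMeasurable (fun x => r * f x) := by
  obtain ⟨c, hc⟩ := hf.bounded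
  exact ⟨hf.measurable.const_mul r, |r| * c, fun x => by
    rw [abs_mul]
    exact mul_le_mul_of_nonneg_left (hc x) (abs_nonneg r)⟩

theorem integrable (hf : IsBoundedMeasurable f) (m : Measure X) [IsFiniteMeasure m] :
    Integrable f m := by
  obtain ⟨c, hc⟩ := hf.bounded
  exact Integrable.of_bound hf.measurable.aestronglyMeasurable c (Eventually.of_forall hc)

end IsBoundedMeasurable

section Integral

variable {X : Type*} [MeasurableSpace X]
variable {E : Type*} [NormedAddCommGroup E] [NormedSpace ℝ E] [Lattice E] [IsOrderedAddMonoid E]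
  [HasSolidNorm E]
variable {ν ξ : MSet X → E}

/-- Order σ-additivity is norm convergence of the partial sums, by order continuity; a continuous
`φ` carries it to ordinary σ-additivity. -/
theorem IsPosMeasure.exists_measure (hE : IsOrderContinuousNorm E (fun e => ‖e‖))
    (h : IsPosMeasure ν) {φ : E →L[ℝ] ℝ} (hφ : Monotone φ) :
    ∃ m : Measure X, IsFiniteMeasure m ∧ ∀ A : MSet X, m.real A.1 = φ (ν A) := by
  have hpos : ∀ A, 0 ≤ φ (ν A) := fun A => by simpa using hφ (h.nonneg A)
  let m : Measure X := Measure.ofMeasurable (fun s hs => ENNReal.ofReal (φ (ν ⟨s, hs⟩)))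
    (by rw [h.empty, map_zero, ENNReal.ofReal_zero]) (by
      intro f hf hd
      have hlub := h.iUnion (fun i => ⟨f i, hf i⟩) fun i j hij => hd hij
      have ht := (φ.continuous.tendsto _).comp
        (tendsto_of_isLUB_range hE (h.monotone_sum _) hlub)
      have hs : HasSum (fun i => φ (ν ⟨f i, hf i⟩)) (φ (ν ⟨⋃ i, f i, MeasurableSet.iUnion hf⟩)) := by
        rw [hasSum_iff_tendsto_nat_of_nonneg fun i => hpos _]
        simpa [Function.comp_def] using ht
      rw [← ENNReal.ofReal_tsum_of_nonneg (fun i => hpos _) hs.summable, hs.tsum_eq])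
  have hm : ∀ A : MSet X, m A.1 = ENNReal.ofReal (φ (ν A)) := fun A =>
    Measure.ofMeasurable_apply A.1 A.2
  refine ⟨m, ⟨?_⟩, fun A => ?_⟩
  · change m (⊤ : MSet X).1 < _
    rw [hm ⊤]
    exact ENNReal.ofReal_lt_top
  · rw [measureReal_def, hm, ENNReal.toReal_ofReal (hpos A)]

theorem map_elementaryIntegral {φ : E →L[ℝ] ℝ} {m : Measure X} [IsFiniteMeasure m]
    (hm : ∀ A : MSet X, m.real A.1 = φ (ν A)) (g : SimpleFunc X ℝ≥0) :
    φ (elementaryIntegral ν g) = ∫ x, (g x : ℝ) ∂m := by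
  have hg : ∀ x, (g x : ℝ) = ∑ r ∈ g.range, (g ⁻¹' {r}).indicator (fun _ => (r : ℝ)) x := by
    intro x
    rw [Finset.sum_eq_single (g x)]
    · simp
    · intro r _ hr
      exact indicator_of_notMem (fun h => hr h.symm) _
    · intro h
      exact absurd (g.mem_range_self x) h
  simp only [hg]
  rw [integral_finsetSum _ fun r _ =>
    (integrable_const _).indicator (g.measurableSet_fiber r), elementaryIntegral, map_sum]
  refine Finset.sum_congr rfl fun r _ => ?_
  rw [integral_indicator_const _ (g.measurableSet_fiber r), map_smul, ← hm, smul_eq_mul,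
    smul_eq_mul, mul_comm]

theorem integrable_simpleFunc (m : Measure X) [IsFiniteMeasure m] (g : SimpleFunc X ℝ≥0) :
    Integrable (fun x => (g x : ℝ)) m :=
  Integrable.of_bound (by fun_prop) (∑ r ∈ g.range, (r : ℝ)) (Eventually.of_forall fun x => by
    rw [Real.norm_of_nonneg (by positivity)]
    exact Finset.single_le_sum (f := fun r : ℝ≥0 => (r : ℝ)) (fun _ _ => by positivity)
      (g.mem_range_self x))

variable [IsOrderedModule ℝ E]

theorem elementaryIntegral_mono (hE : IsOrderContinuousNorm E (fun e => ‖e‖))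
    (h : IsPosMeasure ν) {f g : SimpleFunc X ℝ≥0} (hfg : ∀ x, f x ≤ g x) :
    elementaryIntegral ν f ≤ elementaryIntegral ν g :=
  le_of_forall_monotone fun φ hφ => by
    obtain ⟨m, _, hm⟩ := h.exists_measure hE hφ
    rw [map_elementaryIntegral hm, map_elementaryIntegral hm]
    exact integral_mono (integrable_simpleFunc m f) (integrable_simpleFunc m g) hfg

/-- The defining supremum is a norm limit, so `φ` passes inside, and monotone convergence identifies
the result. It does not involve the approximating sequence, so the order integral is independent of
that sequence. -/
theorem map_hasPosOrderIntegral (hE : IsOrderContinuousNorm E (fun e => ‖e‖))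
    (h : IsPosMeasure ν) {f : X → ℝ≥0} (hf : IsBoundedMeasurable (fun x => (f x : ℝ))) {a : E}
    (ha : HasPosOrderIntegral ν f a) {φ : E →L[ℝ] ℝ} {m : Measure X}
    [IsFiniteMeasure m] (hm : ∀ A : MSet X, m.real A.1 = φ (ν A)) :
    φ a = ∫ x, (f x : ℝ) ∂m := by
  obtain ⟨g, hmono, hlim, hlub⟩ := ha
  have h1 : Tendsto (fun n => φ (elementaryIntegral ν (g n))) atTop (𝓝 (φ a)) :=
    (φ.continuous.tendsto _).comp (tendsto_of_isLUB_range hE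
      (fun i j hij => elementaryIntegral_mono hE h fun x => hmono x hij) hlub)
  simp only [map_elementaryIntegral hm] at h1
  refine tendsto_nhds_unique h1 (integral_tendsto_of_tendsto_of_monotone
    (fun n => integrable_simpleFunc m (g n)) (hf.integrable m) (Eventually.of_forall fun x i j hij =>
      NNReal.coe_le_coe.2 (hmono x hij)) (Eventually.of_forall fun x =>
      NNReal.tendsto_coe.2 (hlim x)))

theorem exists_monotone_simpleFunc {f : X → ℝ≥0} (hf : Measurable f) :
    ∃ g : ℕ → SimpleFunc X ℝ≥0, (∀ x, Monotone fun n => g n x) ∧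
      ∀ x, Tendsto (fun n => g n x) atTop (𝓝 (f x)) := by
  refine ⟨fun n => (SimpleFunc.eapprox (fun x => (f x : ENNReal)) n).map ENNReal.toNNReal,
    fun x i j hij => ?_, fun x => ?_⟩
  · exact ENNReal.toNNReal_mono (SimpleFunc.eapprox_lt_top _ _ _).ne
      (SimpleFunc.monotone_eapprox _ hij x)
  · have := SimpleFunc.tendsto_eapprox (f := fun x => (f x : ENNReal)) (by fun_prop) x
    exact (ENNReal.tendsto_toNNReal ENNReal.coe_ne_top).comp this

variable [CompleteSpace E]

theorem exists_hasPosOrderIntegral (hE : IsOrderContinuousNorm E (fun e => ‖e‖))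
    (h : IsPosMeasure ν) {f : X → ℝ≥0} (hf : IsBoundedMeasurable (fun x => (f x : ℝ))) :
    ∃ a, HasPosOrderIntegral ν f a := by
  obtain ⟨c, hc⟩ := hf.bounded
  obtain ⟨g, hmono, hlim⟩ := exists_monotone_simpleFunc (f := f)
    (by simpa using hf.measurable.real_toNNReal)
  have hm : Monotone fun n => elementaryIntegral ν (g n) := fun i j hij =>
    elementaryIntegral_mono hE h fun x => hmono x hij
  obtain ⟨a, ha⟩ := exists_isLUB_of_bddAbove hE (range_nonempty fun n => elementaryIntegral ν (g n))
    -- The elementary integrals stay below `c • ν ⊤`, which is tested on functionals; Dedekind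
    -- completeness does the rest.
    ⟨c • ν ⊤, by
      rintro _ ⟨n, rfl⟩
      refine le_of_forall_monotone fun φ hφ => ?_
      obtain ⟨m, _, hm⟩ := h.exists_measure hE hφ
      rw [map_elementaryIntegral hm, map_smul, ← hm, smul_eq_mul]
      calc ∫ x, (g n x : ℝ) ∂m ≤ ∫ _, c ∂m := integral_mono (integrable_simpleFunc m _)
            (integrable_const c) fun x => (NNReal.coe_le_coe.2
              ((hmono x).ge_of_tendsto (hlim x) n)).trans ((le_abs_self _).trans (hc x))
        _ = c * m.real (⊤ : MSet X).1 := by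
            rw [integral_const, smul_eq_mul, mul_comm]
            rfl⟩
  exact ⟨a, g, hmono, hlim, ha⟩

theorem map_posOrderIntegral (hE : IsOrderContinuousNorm E (fun e => ‖e‖))
    (h : IsPosMeasure ν) {f : X → ℝ≥0} (hf : IsBoundedMeasurable (fun x => (f x : ℝ)))
    {φ : E →L[ℝ] ℝ} {m : Measure X}
    [IsFiniteMeasure m] (hm : ∀ A : MSet X, m.real A.1 = φ (ν A)) :
    φ (posOrderIntegral ν f) = ∫ x, (f x : ℝ) ∂m := by
  have hex := exists_hasPosOrderIntegral hE h hf
  rw [posOrderIntegral, dif_pos hex]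
  exact map_hasPosOrderIntegral hE h hf hex.choose_spec hm

/-- The formula from which the rules for the order integral follow: an identity or inequality in `E`
is checked after applying every monotone `φ`, where it is one about Lebesgue integrals. -/
theorem map_realOrderIntegral (hE : IsOrderContinuousNorm E (fun e => ‖e‖))
    (h : IsPosMeasure ν) {f : X → ℝ} (hf : IsBoundedMeasurable f)
    {φ : E →L[ℝ] ℝ} {m : Measure X}
    [IsFiniteMeasure m] (hm : ∀ A : MSet X, m.real A.1 = φ (ν A)) :
    φ (realOrderIntegral ν f) = ∫ x, f x ∂m := by
  have hpos : ∀ {f : X → ℝ}, IsBoundedMeasurable f →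
      IsBoundedMeasurable (fun x => ((f x).toNNReal : ℝ)) := by
    intro f hf
    obtain ⟨c, hc⟩ := hf.bounded
    refine ⟨hf.measurable.real_toNNReal.coe_nnreal_real, c, fun x => ?_⟩
    rw [abs_of_nonneg (by positivity), Real.coe_toNNReal']
    exact max_le ((le_abs_self _).trans (hc x)) ((abs_nonneg _).trans (hc x))
  have hneg : IsBoundedMeasurable (fun x => -f x) := by simpa using hf.smul (-1)
  rw [realOrderIntegral, map_sub, map_posOrderIntegral hE h (hpos hf) hm,
    map_posOrderIntegral hE h (hpos hneg) hm,
    ← integral_sub ((hpos hf).integrable m) ((hpos hneg).integrable m)]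
  refine integral_congr_ae (Eventually.of_forall fun x => ?_)
  simp only [Real.coe_toNNReal']
  obtain hx | hx := le_total 0 (f x)
  · rw [max_eq_left hx, max_eq_right (neg_nonpos.2 hx), sub_zero]
  · rw [max_eq_right hx, max_eq_left (neg_nonneg.2 hx), zero_sub, neg_neg]

section RealOrderIntegral

variable (hE : IsOrderContinuousNorm E (fun e => ‖e‖)) {f g : X → ℝ}
include hE

theorem IsPosMeasure.realOrderIntegral_mono (h : IsPosMeasure ν) (hf : IsBoundedMeasurable f)
    (hg : IsBoundedMeasurable g) (hfg : ∀ x, f x ≤ g x) :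
    realOrderIntegral ν f ≤ realOrderIntegral ν g :=
  le_of_forall_monotone fun φ hφ => by
    obtain ⟨m, _, hm⟩ := h.exists_measure hE hφ
    rw [map_realOrderIntegral hE h hf hm, map_realOrderIntegral hE h hg hm]
    exact integral_mono (hf.integrable m) (hg.integrable m) hfg

theorem IsPosMeasure.realOrderIntegral_fun_add (h : IsPosMeasure ν) (hf : IsBoundedMeasurable f)
    (hg : IsBoundedMeasurable g) :
    realOrderIntegral ν (fun x => f x + g x) = realOrderIntegral ν f + realOrderIntegral ν g :=
  eq_of_forall_monotone fun φ hφ => by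
    obtain ⟨m, _, hm⟩ := h.exists_measure hE hφ
    rw [map_add, map_realOrderIntegral hE h hf hm, map_realOrderIntegral hE h hg hm,
      map_realOrderIntegral hE h (hf.add hg) hm,
      integral_add (hf.integrable m) (hg.integrable m)]

theorem IsPosMeasure.realOrderIntegral_fun_smul (h : IsPosMeasure ν) (hf : IsBoundedMeasurable f)
    (r : ℝ) : realOrderIntegral ν (fun x => r * f x) = r • realOrderIntegral ν f :=
  eq_of_forall_monotone fun φ hφ => by
    obtain ⟨m, _, hm⟩ := h.exists_measure hE hφ
    rw [map_smul, map_realOrderIntegral hE h hf hm, map_realOrderIntegral hE h (hf.smul r) hm,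
      integral_const_mul, smul_eq_mul]

theorem IsPosMeasure.realOrderIntegral_indicator (h : IsPosMeasure ν) (A : MSet X) :
    realOrderIntegral ν (A.1.indicator 1) = ν A :=
  eq_of_forall_monotone fun φ hφ => by
    obtain ⟨m, _, hm⟩ := h.exists_measure hE hφ
    rw [map_realOrderIntegral hE h ⟨measurable_one.indicator A.2, 1, fun x => ?_⟩ hm,
      integral_indicator_one A.2, hm]
    by_cases hx : x ∈ A.1 <;> simp [hx]

theorem IsPosMeasure.abs_realOrderIntegral_le (h : IsPosMeasure ν) (hf : IsBoundedMeasurable f)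
    {c : ℝ} (hc : ∀ x, |f x| ≤ c) : |realOrderIntegral ν f| ≤ c • ν ⊤ := by
  have h1 : IsBoundedMeasurable ((⊤ : MSet X).1.indicator (1 : X → ℝ)) :=
    ⟨measurable_one.indicator MeasurableSet.univ, 1, fun x => by
      simp⟩
  have htop : ∀ x, (⊤ : MSet X).1.indicator (1 : X → ℝ) x = 1 := fun x =>
    indicator_of_mem (mem_univ x) _
  have key : ∀ r : ℝ, realOrderIntegral ν (fun x => r * (⊤ : MSet X).1.indicator 1 x)
      = r • ν ⊤ := fun r => by
    rw [h.realOrderIntegral_fun_smul hE h1, h.realOrderIntegral_indicator hE]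
  refine abs_le'.2 ⟨?_, ?_⟩
  · rw [← key]
    refine h.realOrderIntegral_mono hE hf (h1.smul c) fun x => ?_
    rw [htop, mul_one]
    exact (le_abs_self _).trans (hc x)
  · rw [neg_le, ← neg_smul, ← key]
    refine h.realOrderIntegral_mono hE (h1.smul _) hf fun x => ?_
    rw [htop, mul_one]
    exact neg_le.1 ((neg_le_abs _).trans (hc x))

theorem realOrderIntegral_add (h : IsPosMeasure ν) (k : IsPosMeasure ξ)
    (hf : IsBoundedMeasurable f) :
    realOrderIntegral (ν + ξ) f = realOrderIntegral ν f + realOrderIntegral ξ f :=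
  eq_of_forall_monotone fun φ hφ => by
    obtain ⟨m, _, hm⟩ := h.exists_measure hE hφ
    obtain ⟨n, _, hn⟩ := k.exists_measure hE hφ
    rw [map_add, map_realOrderIntegral hE h hf hm, map_realOrderIntegral hE k hf hn,
      map_realOrderIntegral hE (h.add k) hf (m := m + n) fun A => by
        rw [measureReal_add_apply, hm, hn, Pi.add_apply, map_add],
      integral_add_measure (hf.integrable m) (hf.integrable n)]

theorem realOrderIntegral_smul (h : IsPosMeasure ν) {r : ℝ} (hr : 0 ≤ r)
    (hf : IsBoundedMeasurable f) :
    realOrderIntegral (r • ν) f = r • realOrderIntegral ν f := by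
  lift r to ℝ≥0 using hr
  refine eq_of_forall_monotone fun φ hφ => ?_
  obtain ⟨m, _, hm⟩ := h.exists_measure hE hφ
  rw [map_smul, map_realOrderIntegral hE h hf hm,
      map_realOrderIntegral hE (h.smul r.coe_nonneg) hf (m := r • m) fun A => by
        rw [Pi.smul_apply, map_smul, ← hm, measureReal_nnreal_smul_apply, smul_eq_mul],
      integral_smul_nnreal_measure]
  rfl

/-- The order integral does not depend on the decomposition of the measure. -/
theorem orderIntegral_eq {μ : measures X E} (h : IsPosMeasure ν) (k : IsPosMeasure ξ)
    (hμ : μ.1 = ν - ξ) (hf : IsBoundedMeasurable f) :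
    orderIntegral μ f = realOrderIntegral ν f - realOrderIntegral ξ f := by
  obtain ⟨h', k', hμ'⟩ := (exists_decomposition μ).choose_spec
  -- Two decompositions of `μ` have equal cross sums, so additivity in the measure makes the cross
  -- sums of integrals agree.
  rw [orderIntegral, sub_eq_sub_iff_add_eq_add, ← realOrderIntegral_add hE h' k hf,
    ← realOrderIntegral_add hE h k' hf, sub_eq_sub_iff_add_eq_add.1 (hμ'.symm.trans hμ)]

end RealOrderIntegral

end Integral

/-! ### Suprema in ordered groups and a completeness criterion. -/

section OrderedGroup

variable {V : Type*} [AddCommGroup V] [PartialOrder V] [IsOrderedAddMonoid V]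

theorem isLUB_pair_of_isLUB_sub {u v p : V} (h : IsLUB {u - v, 0} p) : IsLUB {u, v} (p + v) := by
  refine ⟨?_, fun w hw => ?_⟩
  · rintro _ (rfl | rfl)
    · exact sub_le_iff_le_add.1 (h.1 (.inl rfl))
    · exact le_add_of_nonneg_left (h.1 (.inr rfl))
  · rw [← le_sub_iff_add_le]
    refine h.2 ?_
    rintro _ (rfl | rfl)
    · exact sub_le_sub_right (hw (.inl rfl)) _
    · exact sub_nonneg.2 (hw (.inr rfl))

theorem isGLB_pair_of_isLUB {u v s : V} (h : IsLUB {u, v} s) : IsGLB {u, v} (u + v - s) := by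
  refine ⟨?_, fun w hw => ?_⟩
  · rintro _ (rfl | rfl)
    · rw [sub_le_iff_le_add]
      exact add_le_add_right (h.1 (.inr rfl)) _
    · rw [sub_le_iff_le_add, add_comm]
      exact add_le_add_right (h.1 (.inl rfl)) _
  · rw [le_sub_comm]
    refine h.2 ?_
    rintro _ (rfl | rfl)
    · rw [le_sub_comm, add_sub_cancel_left]
      exact hw (.inr rfl)
    · rw [le_sub_comm, add_sub_cancel_right]
      exact hw (.inl rfl)

theorem isLUB_neg_pair_of_nonneg {u : V} (h : 0 ≤ u) : IsLUB {u, -u} u := by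
  refine ⟨?_, fun w hw => hw (.inl rfl)⟩
  rintro _ (rfl | rfl)
  · exact le_rfl
  · exact (neg_nonpos.2 h).trans h

theorem modulus_eq [Module ℝ V] {u a : V} (h : IsLUB {u, -u} a) : modulus u = a := by
  have hex : ∃ m, IsLUB {u, -u} m := ⟨a, h⟩
  rw [modulus, dif_pos hex]
  exact hex.choose_spec.unique h

end OrderedGroup

/-- A normed group in which absolutely summable series converge is complete. -/
theorem _root_.AddGroupNorm.exists_limit_of_summable {V : Type*} [AddCommGroup V]
    (G : AddGroupNorm V)
    (h : ∀ u : ℕ → V, Summable (fun n => G (u n)) →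
      ∃ a, Tendsto (fun n => G (∑ i ∈ Finset.range n, u i - a)) atTop (𝓝 0))
    (x : ℕ → V) (hx : ∀ ε > 0, ∃ n₀, ∀ m ≥ n₀, ∀ n ≥ n₀, G (x m - x n) < ε) :
    ∃ v, ∀ ε > 0, ∃ n₀, ∀ n ≥ n₀, G (x n - v) < ε := by
  let _ : NormedAddCommGroup V := G.toNormedAddCommGroup
  have : CompleteSpace V := NormedAddCommGroup.completeSpace_of_summable_imp_tendsto fun u hu =>
    (h u hu).imp fun a ha => tendsto_iff_norm_sub_tendsto_zero.2 ha
  have hcs : CauchySeq x := Metric.cauchySeq_iff.2 fun ε hε => by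
    obtain ⟨N, hN⟩ := hx ε hε
    exact ⟨N, fun m hm n hn => by rw [dist_eq_norm]; exact hN m hm n hn⟩
  obtain ⟨v, hv⟩ := cauchySeq_tendsto_of_complete hcs
  refine ⟨v, fun ε hε => ?_⟩
  obtain ⟨N, hN⟩ := Metric.tendsto_atTop.1 hv ε hε
  exact ⟨N, fun n hn => by have := hN n hn; rwa [dist_eq_norm] at this⟩

/-! ### The Banach lattice of regular measures and its AL, Levi and KB properties. -/

section MeasureLattice

variable {X : Type*} [MeasurableSpace X]
variable {E : Type*} [NormedAddCommGroup E] [NormedSpace ℝ E] [Lattice E] [IsOrderedAddMonoid E]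
  [HasSolidNorm E] [IsOrderedModule ℝ E] [CompleteSpace E]
variable {ν ξ : MSet X → E}

/-- The positive part of a difference of contents. -/
theorem exists_content_posPart (hE : IsOrderContinuousNorm E (fun e => ‖e‖))
    (h : IsContent ν) (k : IsContent ξ) :
    ∃ κ : MSet X → E, IsContent κ ∧ κ ≤ ν ∧ ν - ξ ≤ κ ∧
      ∀ ζ : MSet X → E, IsContent ζ → ν - ξ ≤ ζ → κ ≤ ζ := by
  -- The Hahn–Jordan formula: the positive part at `A` is the supremum of `ν B - ξ B` over
  -- measurable `B ⊆ A`.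
  let S : MSet X → Set E := fun A => {e | ∃ B : MSet X, B.1 ⊆ A.1 ∧ ν B - ξ B = e}
  have hex : ∀ A, ∃ s, IsLUB (S A) s := fun A =>
    exists_isLUB_of_bddAbove hE ⟨_, A, Subset.rfl, rfl⟩ ⟨ν A, by
      rintro _ ⟨B, hB, rfl⟩
      exact (sub_le_self _ (k.nonneg B)).trans (h.mono hB)⟩
  choose κ hκ using hex
  refine ⟨κ, ⟨fun A => (hκ A).1 ⟨∅, by simp, by simp [h.empty, k.empty]⟩, fun A B hAB => ?_⟩,
    fun A => (hκ A).2 ?_, fun A => (hκ A).1 ⟨A, Subset.rfl, rfl⟩,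
    fun ζ hζ hle A => (hκ A).2 ?_⟩
  · refine (hκ (A ∪ B)).unique ?_
    have hadd := (hκ A).add (hκ B)
    -- A measurable subset of a disjoint union splits uniquely, and the supremum of a Minkowski sum
    -- is the sum of the suprema.
    have hS : S A + S B = S (A ∪ B) := by
      ext e
      constructor
      · rintro ⟨_, ⟨C, hC, rfl⟩, _, ⟨D, hD, rfl⟩, rfl⟩
        refine ⟨C ∪ D, by simpa using union_subset_union hC hD, ?_⟩
        have := hAB.mono hC hD
        rw [h.union C D this, k.union C D this]
        exact add_sub_add_comm _ _ _ _
      · rintro ⟨C, hC, rfl⟩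
        refine ⟨_, ⟨C ∩ A, by simp, rfl⟩, _, ⟨C ∩ B, by simp, rfl⟩, ?_⟩
        have hCU : C = (C ∩ A) ∪ (C ∩ B) := Subtype.ext (by
          simp only [MeasurableSet.coe_union, MeasurableSet.coe_inter] at hC ⊢
          rw [← inter_union_distrib_left, inter_eq_left.2 hC])
        have hd : Disjoint (C ∩ A).1 (C ∩ B).1 := hAB.mono (by simp) (by simp)
        conv_rhs => rw [hCU, h.union _ _ hd, k.union _ _ hd]
        exact (add_sub_add_comm _ _ _ _).symm
    rwa [hS] at hadd
  · rintro _ ⟨B, hB, rfl⟩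
    exact (sub_le_self _ (k.nonneg B)).trans (h.mono hB)
  · rintro _ ⟨B, hB, rfl⟩
    exact (hle B).trans (hζ.mono hB)

theorem isContent_of_nonneg (μ : measures X E) (hμ : 0 ≤ μ) : IsContent μ.1 := by
  obtain ⟨⟨ν, ξ⟩, h, k, hμ'⟩ := exists_decomposition μ
  rw [hμ']
  exact h.isContent.sub k.isContent (sub_nonneg.1 (hμ' ▸ hμ))

variable [TopologicalSpace X] [T2Space X] [BorelSpace X]
variable (hE : IsOrderContinuousNorm E (fun e => ‖e‖))
include hE

/-- If `μ = ν - ξ` is positive, it is a content below the regular measure `ν`, hence regular itself.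
-/
theorem isPosRegularMeasure_of_nonneg {μ : regularMeasures X E} (hμ : 0 ≤ μ) :
    IsPosRegularMeasure μ.1 := by
  obtain ⟨ν, ξ, h, k, hμ'⟩ := exists_regular_decomposition hE μ.2
  refine (isContent_of_nonneg (Submodule.inclusion regularMeasures_le μ)
    hμ).isPosRegularMeasure_of_le hE h ?_
  rw [hμ']
  exact sub_le_self _ fun A => k.nonneg A

/-- The positive part of a regular measure is its positive part in the space of measures. -/
theorem exists_isLUB_posPart (μ : regularMeasures X E) :
    ∃ p : regularMeasures X E, IsLUB {μ, 0} p ∧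
      IsLUB {Submodule.inclusion regularMeasures_le μ, 0}
        (Submodule.inclusion regularMeasures_le p) := by
  obtain ⟨ν, ξ, h, k, hμ⟩ := exists_regular_decomposition hE μ.2
  obtain ⟨κ, hκ, hκν, hle, hmin⟩ := exists_content_posPart hE h.toIsPosMeasure.isContent
    k.toIsPosMeasure.isContent
  rw [← hμ] at hle hmin
  let p : regularMeasures X E :=
    ⟨κ, Submodule.subset_span (hκ.isPosRegularMeasure_of_le hE h hκν)⟩
  have hlub : IsLUB {Submodule.inclusion regularMeasures_le μ, 0}
      (Submodule.inclusion regularMeasures_le p) := by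
    refine ⟨?_, fun w hw => ?_⟩
    · rintro _ (rfl | rfl)
      · exact hle
      · exact fun A => hκ.nonneg A
    · exact hmin w.1 (isContent_of_nonneg w (hw (.inr rfl))) (hw (.inl rfl))
  refine ⟨p, ⟨?_, fun w hw => ?_⟩, hlub⟩
  · rintro _ (rfl | rfl)
    · exact hle
    · exact fun A => hκ.nonneg A
  · refine show Submodule.inclusion regularMeasures_le p ≤
      Submodule.inclusion regularMeasures_le w from hlub.2 ?_
    rintro _ (rfl | rfl)
    · exact hw (.inl rfl)
    · exact hw (.inr rfl)

theorem exists_isLUB_pair (μ ρ : regularMeasures X E) :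
    ∃ s : regularMeasures X E, IsLUB {μ, ρ} s ∧
      IsLUB {Submodule.inclusion regularMeasures_le μ, Submodule.inclusion regularMeasures_le ρ}
        (Submodule.inclusion regularMeasures_le s) := by
  obtain ⟨p, h1, h2⟩ := exists_isLUB_posPart hE (μ - ρ)
  rw [map_sub] at h2
  exact ⟨p + ρ, isLUB_pair_of_isLUB_sub h1, by
    rw [map_add]
    exact isLUB_pair_of_isLUB_sub h2⟩

/-- The norm is defined by the modulus among all measures. Suprema of regular measures are the same
in both spaces, so the modulus among the regular ones may be used. -/
theorem regularMeasureNorm_eq {μ a : regularMeasures X E} (ha : IsLUB {μ, -μ} a) :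
    regularMeasureNorm μ = ‖a.1 ⊤‖ := by
  obtain ⟨s, h1, h2⟩ := exists_isLUB_pair hE μ (-μ)
  rw [map_neg] at h2
  rw [regularMeasureNorm, measureNorm, modulus_eq h2, h1.unique ha]
  rfl

theorem regularMeasureNorm_of_nonneg {μ : regularMeasures X E} (hμ : 0 ≤ μ) :
    regularMeasureNorm μ = ‖μ.1 ⊤‖ :=
  regularMeasureNorm_eq hE (isLUB_neg_pair_of_nonneg hμ)

theorem exists_isLUB_neg (μ : regularMeasures X E) :
    ∃ a : regularMeasures X E, IsLUB {μ, -μ} a ∧ 0 ≤ a := by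
  obtain ⟨a, ha, -⟩ := exists_isLUB_pair hE μ (-μ)
  refine ⟨a, ha, fun A => ?_⟩
  have h1 : μ.1 A ≤ a.1 A := ha.1 (.inl rfl) A
  have h2 : -μ.1 A ≤ a.1 A := ha.1 (.inr rfl) A
  exact (abs_nonneg _).trans (abs_le'.2 ⟨h1, h2⟩)

theorem regularMeasureNorm_le {μ a : regularMeasures X E} (h1 : μ ≤ a) (h2 : -μ ≤ a) :
    regularMeasureNorm μ ≤ ‖a.1 ⊤‖ := by
  obtain ⟨b, hb, hb0⟩ := exists_isLUB_neg hE μ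
  rw [regularMeasureNorm_eq hE hb]
  refine norm_le_norm_of_nonneg_of_le (hb0 _) ((show b ≤ a from hb.2 ?_) _)
  rintro _ (rfl | rfl) <;> assumption

theorem norm_apply_le_regularMeasureNorm (μ : regularMeasures X E) (A : MSet X) :
    ‖μ.1 A‖ ≤ regularMeasureNorm μ := by
  obtain ⟨a, ha, ha0⟩ := exists_isLUB_neg hE μ
  rw [regularMeasureNorm_eq hE ha]
  have hc := (isPosRegularMeasure_of_nonneg hE ha0).toIsPosMeasure.isContent
  refine norm_le_norm_of_abs_le_abs ?_
  rw [abs_of_nonneg (ha0 ⊤)]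
  exact (abs_le'.2 ⟨ha.1 (.inl rfl) A, ha.1 (.inr rfl) A⟩).trans (hc.mono (subset_univ _))

theorem regularMeasureNorm_eq_zero (μ : regularMeasures X E) :
    regularMeasureNorm μ = 0 ↔ μ = 0 := by
  constructor
  · intro h
    refine Subtype.ext (funext fun A => norm_le_zero_iff.1 ?_)
    rw [← h]
    exact norm_apply_le_regularMeasureNorm hE μ A
  · rintro rfl
    rw [regularMeasureNorm_of_nonneg hE le_rfl]
    exact norm_zero

theorem regularMeasureNorm_nonneg (μ : regularMeasures X E) : 0 ≤ regularMeasureNorm μ :=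
  norm_nonneg _

theorem regularMeasureNorm_neg (μ : regularMeasures X E) :
    regularMeasureNorm (-μ) = regularMeasureNorm μ := by
  obtain ⟨a, ha, -⟩ := exists_isLUB_neg hE μ
  rw [regularMeasureNorm_eq hE ha, regularMeasureNorm_eq hE (a := a)]
  rwa [neg_neg, pair_comm]

theorem regularMeasureNorm_smul (r : ℝ) (μ : regularMeasures X E) :
    regularMeasureNorm (r • μ) = |r| * regularMeasureNorm μ := by
  have hpos : ∀ r : ℝ, 0 ≤ r → regularMeasureNorm (r • μ) = r * regularMeasureNorm μ := by
    intro r hr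
    obtain rfl | hr := hr.eq_or_lt
    · rw [zero_smul, zero_mul, regularMeasureNorm_eq_zero hE]
    obtain ⟨a, ha, -⟩ := exists_isLUB_neg hE μ
    have hra : IsLUB {r • μ, -(r • μ)} (r • a) := by
      refine ⟨?_, fun w hw => ?_⟩
      · rintro _ (rfl | rfl) A
        · exact smul_le_smul_of_nonneg_left (ha.1 (.inl rfl) A) hr.le
        · change -(r • μ.1 A) ≤ r • a.1 A
          rw [← smul_neg]
          exact smul_le_smul_of_nonneg_left (ha.1 (.inr rfl) A) hr.le
      · have hle : a ≤ r⁻¹ • w := by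
          refine ha.2 ?_
          rintro _ (rfl | rfl) A
          · exact (le_inv_smul_iff_of_pos hr).2 (hw (.inl rfl) A)
          · refine (le_inv_smul_iff_of_pos hr).2 ?_
            have : -(r • μ.1 A) ≤ w.1 A := hw (.inr rfl) A
            rw [← smul_neg] at this
            exact this
        exact fun A => (le_inv_smul_iff_of_pos hr).1 (hle A)
    rw [regularMeasureNorm_eq hE hra, regularMeasureNorm_eq hE ha]
    exact (norm_smul _ _).trans (by rw [Real.norm_of_nonneg hr.le])
  obtain hr | hr := le_total 0 r
  · rw [hpos r hr, abs_of_nonneg hr]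
  · rw [← regularMeasureNorm_neg hE, show -(r • μ) = (-r) • μ from (neg_smul r μ).symm, hpos _ (neg_nonneg.2 hr), abs_of_nonpos hr]

theorem regularMeasureNorm_add_le (μ ρ : regularMeasures X E) :
    regularMeasureNorm (μ + ρ) ≤ regularMeasureNorm μ + regularMeasureNorm ρ := by
  obtain ⟨a, ha, -⟩ := exists_isLUB_neg hE μ
  obtain ⟨b, hb, -⟩ := exists_isLUB_neg hE ρ
  rw [regularMeasureNorm_eq hE ha, regularMeasureNorm_eq hE hb]
  refine (regularMeasureNorm_le hE (a := a + b) (add_le_add (ha.1 (.inl rfl)) (hb.1 (.inl rfl)))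
    ?_).trans (norm_add_le _ _)
  rw [neg_add]
  exact add_le_add (ha.1 (.inr rfl)) (hb.1 (.inr rfl))

/-- Norm summable series of positive regular measures converge. -/
theorem exists_hasSum_of_nonneg {p : ℕ → regularMeasures X E} (hp : ∀ n, 0 ≤ p n)
    (hs : Summable fun n => regularMeasureNorm (p n)) :
    ∃ P : regularMeasures X E, (∀ n, ∑ i ∈ Finset.range n, p i ≤ P) ∧
      Tendsto (fun n => regularMeasureNorm (P - ∑ i ∈ Finset.range n, p i)) atTop (𝓝 0) := by
  have hsum : ∀ A, Summable fun n => (p n).1 A := fun A =>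
    Summable.of_norm_bounded hs fun n => norm_apply_le_regularMeasureNorm hE (p n) A
  have hfin : ∀ n A, (∑ i ∈ Finset.range n, p i).1 A = ∑ i ∈ Finset.range n, (p i).1 A := by
    intro n A
    simp
  have hnn : ∀ n, 0 ≤ ∑ i ∈ Finset.range n, p i := fun n => Finset.sum_nonneg fun i _ => hp i
  have hcont : IsContent fun A => ∑' n, (p n).1 A := by
    refine ⟨fun A => tsum_nonneg fun n => hp n A, fun A B hAB => ?_⟩
    rw [← (hsum A).tsum_add (hsum B)]
    exact tsum_congr fun n =>
      (isPosRegularMeasure_of_nonneg hE (hp n)).toIsPosMeasure.isContent.union A B hAB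
  have hreg : IsPosRegularMeasure fun A => ∑' n, (p n).1 A := by
    refine hcont.isPosRegularMeasure_of_norm_le hE fun ε hε => ?_
    -- A finite partial sum is regular and approximates the setwise sum within `ε`, uniformly in
    -- `A`, by the tail of the series of norms.
    obtain ⟨n, hn⟩ := Metric.tendsto_atTop.1 (tendsto_sum_nat_add fun n => regularMeasureNorm (p n))
      ε hε
    refine ⟨_, isPosRegularMeasure_of_nonneg hE (hnn n), fun A => ?_⟩
    rw [← (hsum A).sum_add_tsum_nat_add n, hfin]
    refine (norm_add_le _ _).trans (add_le_add_right ?_ _)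
    have hsn : Summable fun i => regularMeasureNorm (p (i + n)) := (summable_nat_add_iff n).2 hs
    refine (tsum_of_norm_bounded hsn.hasSum fun i =>
      norm_apply_le_regularMeasureNorm hE (p (i + n)) A).trans ?_
    have := hn n le_rfl
    rw [dist_zero_right] at this
    exact (le_abs_self _).trans this.le
  let P : regularMeasures X E := ⟨_, Submodule.subset_span hreg⟩
  have hle : ∀ n, ∑ i ∈ Finset.range n, p i ≤ P := fun n A => by
    rw [hfin]
    exact (hsum A).sum_le_tsum _ fun i _ => hp i A
  refine ⟨P, hle, ?_⟩
  have ht := (hsum ⊤).hasSum.tendsto_sum_nat.const_sub (P.1 ⊤)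
  rw [show P.1 ⊤ - ∑' n, (p n).1 ⊤ = 0 from sub_self _] at ht
  refine (tendsto_zero_iff_norm_tendsto_zero.1 ht).congr fun n => ?_
  rw [regularMeasureNorm_of_nonneg hE (sub_nonneg.2 (hle n)), ← hfin]
  rfl

/-- It suffices to sum absolutely summable series. With `p` the positive part of a term `u`, write
`u = p - (p - u)`; both series have positive terms and summable norms, because `0 ≤ p ≤ |u|`. -/
theorem regularMeasures_complete (x : ℕ → regularMeasures X E)
    (hx : ∀ ε > 0, ∃ n₀, ∀ m ≥ n₀, ∀ n ≥ n₀, regularMeasureNorm (x m - x n) < ε) :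
    ∃ v, ∀ ε > 0, ∃ n₀, ∀ n ≥ n₀, regularMeasureNorm (x n - v) < ε := by
  let G : AddGroupNorm (regularMeasures X E) :=
    { toFun := regularMeasureNorm
      map_zero' := (regularMeasureNorm_eq_zero hE 0).2 rfl
      add_le' := regularMeasureNorm_add_le hE
      neg' := regularMeasureNorm_neg hE
      eq_zero_of_map_eq_zero' := fun μ h => (regularMeasureNorm_eq_zero hE μ).1 h }
  refine G.exists_limit_of_summable (fun u hu => ?_) x hx
  choose p hp _ using fun n => exists_isLUB_posPart hE (u n)
  have hp0 : ∀ n, 0 ≤ p n := fun n => (hp n).1 (.inr rfl)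
  have hq0 : ∀ n, 0 ≤ p n - u n := fun n => sub_nonneg.2 ((hp n).1 (.inl rfl))
  have hpn : ∀ n, regularMeasureNorm (p n) ≤ regularMeasureNorm (u n) := fun n => by
    obtain ⟨a, ha, ha0⟩ := exists_isLUB_neg hE (u n)
    have hpa : p n ≤ a := (hp n).2 (by
      rintro _ (rfl | rfl)
      · exact ha.1 (.inl rfl)
      · exact ha0)
    rw [regularMeasureNorm_eq hE ha]
    exact regularMeasureNorm_le hE hpa ((neg_nonpos.2 (hp0 n)).trans ha0)
  have hps : Summable fun n => regularMeasureNorm (p n) :=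
    hu.of_nonneg_of_le (fun n => regularMeasureNorm_nonneg hE _) hpn
  have hqs : Summable fun n => regularMeasureNorm (p n - u n) :=
    (hps.add hu).of_nonneg_of_le (fun n => regularMeasureNorm_nonneg hE _) fun n => by
      rw [sub_eq_add_neg]
      refine (regularMeasureNorm_add_le hE _ _).trans ?_
      rw [regularMeasureNorm_neg hE]
      rfl
  obtain ⟨P, -, hP⟩ := exists_hasSum_of_nonneg hE hp0 hps
  obtain ⟨Q, -, hQ⟩ := exists_hasSum_of_nonneg hE hq0 hqs
  refine ⟨P - Q, squeeze_zero (fun n => regularMeasureNorm_nonneg hE _)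
    (fun n => ?_) (by simpa using hP.add hQ)⟩
  change regularMeasureNorm _ ≤ _
  rw [← regularMeasureNorm_neg hE (P - _)]
  refine le_trans (le_of_eq (congrArg _ ?_)) (regularMeasureNorm_add_le hE _ _)
  abel_nf

theorem isBanachLattice_regularMeasures :
    IsBanachLattice (regularMeasures X E) regularMeasureNorm where
  le_antisymm _ _ := le_antisymm
  add_le_add_right _ _ w h := add_le_add_left h w
  smul_nonneg r v hr hv A := smul_nonneg hr (hv A)
  exists_sup u v := (exists_isLUB_pair hE u v).imp fun _ h => h.1
  exists_inf u v := by
    obtain ⟨s, hs, -⟩ := exists_isLUB_pair hE u v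
    exact ⟨_, isGLB_pair_of_isLUB hs⟩
  norm_nonneg := regularMeasureNorm_nonneg hE
  norm_eq_zero := regularMeasureNorm_eq_zero hE
  norm_smul := regularMeasureNorm_smul hE
  norm_add_le := regularMeasureNorm_add_le hE
  norm_solid u v a b ha hb hab := by
    rw [regularMeasureNorm_eq hE hb]
    exact regularMeasureNorm_le hE ((ha.1 (.inl rfl)).trans hab) ((ha.1 (.inr rfl)).trans hab)
  complete := regularMeasures_complete hE

/-- An increasing net of positive regular measures with bounded total masses converges in norm to
its supremum. -/
theorem exists_isLUB_of_bddAbove_mass {D : Set (regularMeasures X E)} (hne : D.Nonempty)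
    (hdir : DirectedOn (· ≤ ·) D) (hD : ∀ v ∈ D, 0 ≤ v)
    (hbdd : BddAbove ((fun v : regularMeasures X E => v.1 ⊤) '' D)) :
    ∃ s, IsLUB D s ∧
      ∀ ε > 0, ∃ d ∈ D, ∀ d' ∈ D, d ≤ d' → regularMeasureNorm (d' - s) < ε := by
  have hc : ∀ d ∈ D, IsContent d.1 := fun d hd =>
    (isPosRegularMeasure_of_nonneg hE (hD d hd)).toIsPosMeasure.isContent
  have hdirA : ∀ A : MSet X, DirectedOn (· ≤ ·) ((fun v : regularMeasures X E => v.1 A) '' D) := by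
    rintro A _ ⟨d, hd, rfl⟩ _ ⟨d', hd', rfl⟩
    obtain ⟨e, he, h1, h2⟩ := hdir d hd d' hd'
    exact ⟨_, ⟨e, he, rfl⟩, h1 A, h2 A⟩
  have hex : ∀ A : MSet X, ∃ s, IsLUB ((fun v : regularMeasures X E => v.1 A) '' D) s := by
    intro A
    refine exists_isLUB_of_bddAbove hE (hne.image _) ?_
    obtain ⟨u, hu⟩ := hbdd
    refine ⟨u, ?_⟩
    rintro _ ⟨d, hd, rfl⟩
    exact ((hc d hd).mono (subset_univ _)).trans (hu ⟨d, hd, rfl⟩)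
  -- The supremum is taken setwise. Directedness gives its additivity, and order continuity at `X`
  -- alone controls the error on every set, since `s - d` is a content.
  choose s hs using hex
  have hle : ∀ d ∈ D, d.1 ≤ s := fun d hd A => (hs A).1 ⟨d, hd, rfl⟩
  have hscont : IsContent s := by
    refine ⟨fun A => ?_, fun A B hAB => le_antisymm ((hs _).2 ?_) ?_⟩
    · obtain ⟨d, hd⟩ := hne
      exact (hD d hd A).trans (hle d hd A)
    · rintro _ ⟨d, hd, rfl⟩
      simp only
      rw [(hc d hd).union A B hAB]
      exact add_le_add (hle d hd A) (hle d hd B)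
    · refine ((hs A).add (hs B)).2 ?_
      rintro _ ⟨_, ⟨d, hd, rfl⟩, _, ⟨d', hd', rfl⟩, rfl⟩
      obtain ⟨e, he, h1, h2⟩ := hdir d hd d' hd'
      refine (add_le_add (h1 A) (h2 B)).trans ?_
      have := hle e he (A ∪ B)
      rwa [(hc e he).union A B hAB] at this
  have happrox : ∀ ε > 0, ∃ d ∈ D, ∀ d' ∈ D, d ≤ d' → ‖s ⊤ - d'.1 ⊤‖ < ε := by
    intro ε hε
    obtain ⟨_, ⟨d, hd, rfl⟩, h⟩ :=
      exists_norm_sub_lt_of_isLUB hE (hne.image _) (hdirA ⊤) (hs ⊤) hε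
    exact ⟨d, hd, fun d' hd' hdd => h _ ⟨d', hd', rfl⟩ (hdd ⊤)⟩
  have hreg : IsPosRegularMeasure s := by
    refine hscont.isPosRegularMeasure_of_norm_le hE fun ε hε => ?_
    obtain ⟨d, hd, h⟩ := happrox ε hε
    refine ⟨d.1, isPosRegularMeasure_of_nonneg hE (hD d hd), fun A => ?_⟩
    have h1 := (hscont.sub (hc d hd) (hle d hd)).norm_mono (A := A) (B := ⊤) (subset_univ _)
    have h2 := norm_le_norm_add_norm_sub' (s A) (d.1 A)
    simp only [Pi.sub_apply] at h1
    linarith [h d hd le_rfl]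
  let S : regularMeasures X E := ⟨s, Submodule.subset_span hreg⟩
  have hSD : ∀ d ∈ D, d ≤ S := hle
  refine ⟨S, ⟨hSD, fun u hu A => (hs A).2 ?_⟩, fun ε hε => ?_⟩
  · rintro _ ⟨d, hd, rfl⟩
    exact hu hd A
  · obtain ⟨d, hd, h⟩ := happrox ε hε
    refine ⟨d, hd, fun d' hd' hdd => ?_⟩
    rw [← regularMeasureNorm_neg hE, neg_sub,
      regularMeasureNorm_of_nonneg hE (sub_nonneg.2 (hSD d' hd'))]
    exact h d' hd' hdd

omit hE in
-- The norm limit of an increasing net is its supremum: each `d` is eventually dominated by members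
-- close to the limit.
theorem IsKBNorm.isLeviNorm (h : IsKBNorm E (fun e => ‖e‖)) : IsLeviNorm E (fun e => ‖e‖) := by
  intro D hne hdir hD hbdd
  obtain ⟨s, hs⟩ := h D hne hdir hD hbdd
  refine ⟨s, isLUB_of_forall_exists_norm_sub_lt (fun d hd => ?_) fun ε hε => ?_⟩
  · refine sub_nonpos.1 (le_zero_of_forall_exists_norm_lt fun ε hε => ?_)
    obtain ⟨e, he, h1⟩ := hs ε hε
    obtain ⟨e', he', h2, h3⟩ := hdir d hd e he
    exact ⟨e' - s, sub_le_sub_right h2 s, h1 e' he' h3⟩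
  · obtain ⟨e, he, h1⟩ := hs ε hε
    exact ⟨e, he, by rw [norm_sub_rev]; exact h1 e he le_rfl⟩

/-- On the positive cone the norm is that of the total mass, so the masses form a norm bounded
increasing net in `E`. -/
theorem IsLeviNorm.bddAbove_mass (h : IsLeviNorm E (fun e => ‖e‖))
    {D : Set (regularMeasures X E)} (hne : D.Nonempty)
    (hdir : DirectedOn (· ≤ ·) D) (hD : ∀ v ∈ D, 0 ≤ v)
    (hbdd : ∃ C : ℝ, ∀ v ∈ D, regularMeasureNorm v ≤ C) :
    BddAbove ((fun v : regularMeasures X E => v.1 ⊤) '' D) := by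
  obtain ⟨C, hC⟩ := hbdd
  obtain ⟨s, hs⟩ := h ((fun v : regularMeasures X E => v.1 ⊤) '' D) (hne.image _) (by
    rintro _ ⟨d, hd, rfl⟩ _ ⟨d', hd', rfl⟩
    obtain ⟨e, he, h1, h2⟩ := hdir d hd d' hd'
    exact ⟨_, ⟨e, he, rfl⟩, h1 ⊤, h2 ⊤⟩) (by
    rintro _ ⟨d, hd, rfl⟩
    exact hD d hd ⊤) ⟨C, by
    rintro _ ⟨d, hd, rfl⟩
    simp only
    rw [← regularMeasureNorm_of_nonneg hE (hD d hd)]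
    exact hC d hd⟩
  exact ⟨s, hs.1⟩

variable [Nonempty X]

/-- The embedding of the positive cone by point masses. -/
theorem exists_pointMass_embedding :
    ∃ δ : E → regularMeasures X E, (∀ e, 0 ≤ e → 0 ≤ δ e) ∧
      (∀ e, 0 ≤ e → (δ e).1 ⊤ = e) ∧ (∀ e e', 0 ≤ e → e ≤ e' → δ e ≤ δ e') ∧
      (∀ e e', 0 ≤ e → 0 ≤ e' → δ (e + e') = δ e + δ e') ∧
      ∀ e, 0 ≤ e → regularMeasureNorm (δ e) = ‖e‖ := by
  classical
  obtain ⟨x⟩ := ‹Nonempty X›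
  let δ : E → regularMeasures X E := fun e => if he : 0 ≤ e then
    ⟨pointMass x e, Submodule.subset_span (isPosRegularMeasure_pointMass x he)⟩ else 0
  have hδ : ∀ e, 0 ≤ e → (δ e).1 = pointMass x e := fun e he => by simp only [δ, dif_pos he]
  have h0 : ∀ e, 0 ≤ e → 0 ≤ δ e := fun e he A => by
    rw [hδ e he]
    exact (isPosRegularMeasure_pointMass x he).nonneg A
  have htop : ∀ e, 0 ≤ e → (δ e).1 ⊤ = e := fun e he => by
    rw [hδ e he]
    exact indicator_of_mem (mem_univ x) _
  refine ⟨δ, h0, htop, fun e e' he hee A => ?_, fun e e' he he' => ?_, fun e he => ?_⟩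
  · rw [hδ e he, hδ e' (he.trans hee)]
    exact indicator_le_indicator hee
  · refine Subtype.ext ?_
    rw [hδ _ (add_nonneg he he'), Submodule.coe_add, hδ e he, hδ e' he']
    exact funext fun A => congrFun (indicator_add A.1 (fun _ => e) (fun _ => e')) x
  · rw [regularMeasureNorm_of_nonneg hE (h0 e he), htop e he]

theorem isALNorm_regularMeasures_iff :
    IsALNorm (regularMeasures X E) regularMeasureNorm ↔ IsALNorm E (fun e => ‖e‖) := by
  constructor
  · intro h e e' he he'
    obtain ⟨δ, h0, -, -, hadd, hnorm⟩ := exists_pointMass_embedding (X := X) hE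
    have := h (δ e) (δ e') (h0 e he) (h0 e' he')
    rwa [← hadd e e' he he', hnorm _ (add_nonneg he he'), hnorm e he, hnorm e' he'] at this
  · intro h u v hu hv
    rw [regularMeasureNorm_of_nonneg hE hu, regularMeasureNorm_of_nonneg hE hv,
      regularMeasureNorm_of_nonneg hE (add_nonneg hu hv)]
    exact h _ _ (hu ⊤) (hv ⊤)

theorem exists_directed_pointMass {D : Set E} (hne : D.Nonempty)
    (hdir : DirectedOn (· ≤ ·) D) (hD : ∀ v ∈ D, 0 ≤ v) (hbdd : ∃ C : ℝ, ∀ v ∈ D, ‖v‖ ≤ C) :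
    ∃ δ : E → regularMeasures X E, (∀ e, 0 ≤ e → (δ e).1 ⊤ = e) ∧
      (∀ e e', 0 ≤ e → e ≤ e' → δ e ≤ δ e') ∧ (δ '' D).Nonempty ∧
      DirectedOn (· ≤ ·) (δ '' D) ∧ (∀ v ∈ δ '' D, 0 ≤ v) ∧
      ∃ C : ℝ, ∀ v ∈ δ '' D, regularMeasureNorm v ≤ C := by
  obtain ⟨δ, h0, htop, hmono, -, hnorm⟩ := exists_pointMass_embedding (X := X) hE
  refine ⟨δ, htop, hmono, hne.image _, ?_, ?_, ?_⟩
  · rintro _ ⟨d, hd, rfl⟩ _ ⟨d', hd', rfl⟩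
    obtain ⟨e, he, h1, h2⟩ := hdir d hd d' hd'
    exact ⟨_, ⟨e, he, rfl⟩, hmono _ _ (hD d hd) h1, hmono _ _ (hD d' hd') h2⟩
  · rintro _ ⟨d, hd, rfl⟩
    exact h0 d (hD d hd)
  · obtain ⟨C, hC⟩ := hbdd
    refine ⟨C, ?_⟩
    rintro _ ⟨d, hd, rfl⟩
    rw [hnorm d (hD d hd)]
    exact hC d hd

theorem isLeviNorm_regularMeasures_iff :
    IsLeviNorm (regularMeasures X E) regularMeasureNorm ↔ IsLeviNorm E (fun e => ‖e‖) := by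
  constructor
  · intro h D hne hdir hD hbdd
    obtain ⟨δ, htop, hmono, h1, h2, h3, h4⟩ :=
      exists_directed_pointMass (X := X) hE hne hdir hD hbdd
    obtain ⟨s, hs⟩ := h _ h1 h2 h3 h4
    refine ⟨s.1 ⊤, fun d hd => ?_, fun u hu => ?_⟩
    · have := hs.1 ⟨d, hd, rfl⟩ ⊤
      rwa [htop d (hD d hd)] at this
    · have hu0 : 0 ≤ u := by
        obtain ⟨d, hd⟩ := hne
        exact (hD d hd).trans (hu hd)
      -- An upper bound `u` in `E` yields the upper bound `δ u` among the measures; evaluating at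
      -- `X` returns to `E`.
      have : s ≤ δ u := hs.2 (by
        rintro _ ⟨d, hd, rfl⟩
        exact hmono d u (hD d hd) (hu hd))
      have := this ⊤
      rwa [htop u hu0] at this
  · intro h D hne hdir hD hbdd
    obtain ⟨s, hs, -⟩ :=
      exists_isLUB_of_bddAbove_mass hE hne hdir hD (h.bddAbove_mass hE hne hdir hD hbdd)
    exact ⟨s, hs⟩

theorem isKBNorm_regularMeasures_iff :
    IsKBNorm (regularMeasures X E) regularMeasureNorm ↔ IsKBNorm E (fun e => ‖e‖) := by
  constructor
  · intro h D hne hdir hD hbdd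
    obtain ⟨δ, htop, hmono, h1, h2, h3, h4⟩ :=
      exists_directed_pointMass (X := X) hE hne hdir hD hbdd
    obtain ⟨s, hs⟩ := h _ h1 h2 h3 h4
    refine ⟨s.1 ⊤, fun ε hε => ?_⟩
    obtain ⟨_, ⟨d, hd, rfl⟩, hlt⟩ := hs ε hε
    refine ⟨d, hd, fun d' hd' hdd => ?_⟩
    have h5 := norm_apply_le_regularMeasureNorm hE (δ d' - s) ⊤
    rw [Submodule.coe_sub, Pi.sub_apply, htop d' (hD d' hd')] at h5
    exact h5.trans_lt (hlt _ ⟨d', hd', rfl⟩ (hmono _ _ (hD d hd) hdd))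
  · intro h D hne hdir hD hbdd
    obtain ⟨s, -, hs⟩ := exists_isLUB_of_bddAbove_mass hE hne hdir hD
      (h.isLeviNorm.bddAbove_mass hE hne hdir hD hbdd)
    exact ⟨s, hs⟩

end MeasureLattice

/-! ### Riesz representation of positive operators on `C_c(X)`. -/

section Representation

variable {X : Type*} [TopologicalSpace X]
variable {E : Type*} [NormedAddCommGroup E] [NormedSpace ℝ E] [Lattice E] [IsOrderedAddMonoid E]
  [HasSolidNorm E] [IsOrderedModule ℝ E] [CompleteSpace E]

theorem exists_bump [T2Space X] [LocallyCompactSpace X] {K V : Set X} (hK : IsCompact K)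
    (hV : IsOpen V) (hKV : K ⊆ V) :
    ∃ f : C_c(X, ℝ), (∀ x, 0 ≤ f x ∧ f x ≤ 1) ∧ (∀ x ∈ K, f x = 1) ∧ ∀ x ∉ V, f x = 0 := by
  obtain ⟨f, h1, h2, h3, h4⟩ := exists_continuousMap_one_of_isCompact_subset_isOpen hK hV hKV
  exact ⟨⟨f, h2⟩, h4, h1, fun x hx => image_eq_zero_of_notMem_tsupport fun h => hx (h3 h)⟩

theorem isBoundedMeasurable_compactlySupported [MeasurableSpace X] [BorelSpace X] (f : C_c(X, ℝ)) :
    IsBoundedMeasurable f := by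
  refine ⟨f.continuous.measurable, ?_⟩
  obtain ⟨c, hc⟩ := f.hasCompactSupport.exists_bound_of_continuous f.continuous
  exact ⟨c, fun x => by simpa using hc x⟩

theorem IsPositiveOperator.mono {F : Type*} [AddCommGroup F] [Module ℝ F] [FunLike F X ℝ]
    (hF : ∀ (f g : F) x, (f - g) x = f x - g x) {T : F →ₗ[ℝ] E}
    (hT : IsPositiveOperator T) {f g : F} (h : ∀ x, f x ≤ g x) : T f ≤ T g := by
  rw [← sub_nonneg, ← map_sub]
  exact hT _ fun x => by
    rw [hF]
    exact sub_nonneg.2 (h x)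

theorem exists_isGLB_of_bddBelow (hE : IsOrderContinuousNorm E (fun e => ‖e‖)) {S : Set E}
    (hne : S.Nonempty) (hbdd : BddBelow S) : ∃ s, IsGLB S s := by
  obtain ⟨s, hs⟩ := exists_isLUB_of_bddAbove hE hne.neg hbdd.neg
  exact ⟨-s, by simpa using hs.neg⟩

/-- The set whose supremum is the measure of the open set `V`. -/
def testValues (T : C_c(X, ℝ) →ₗ[ℝ] E) (V : Set X) : Set E :=
  {e | ∃ f : C_c(X, ℝ), (∀ x, 0 ≤ f x ∧ f x ≤ 1) ∧ (∀ x ∉ V, f x = 0) ∧ T f = e}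

section

variable {T : C_c(X, ℝ) →ₗ[ℝ] E}

theorem zero_mem_testValues (V : Set X) : 0 ∈ testValues T V :=
  ⟨0, by simp, by simp, map_zero T⟩

theorem directedOn_testValues (hT : IsPositiveOperator T) (V : Set X) :
    DirectedOn (· ≤ ·) (testValues T V) := by
  rintro _ ⟨f, hf, hfV, rfl⟩ _ ⟨g, hg, hgV, rfl⟩
  refine ⟨_, ⟨f ⊔ g, fun x => ?_, fun x hx => ?_, rfl⟩,
    hT.mono (fun _ _ _ => rfl) fun x => ?_, hT.mono (fun _ _ _ => rfl) fun x => ?_⟩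
  · exact ⟨(hf x).1.trans le_sup_left, sup_le (hf x).2 (hg x).2⟩
  · simp [hfV x hx, hgV x hx]
  · exact le_sup_left
  · exact le_sup_right

theorem testValues_mono {V W : Set X} (h : V ⊆ W) : testValues T V ⊆ testValues T W := by
  rintro _ ⟨f, hf, hfV, rfl⟩
  exact ⟨f, hf, fun x hx => hfV x fun hxV => hx (h hxV), rfl⟩

end

variable [T2Space X] [LocallyCompactSpace X] [MeasurableSpace X] [BorelSpace X]

/-- Riesz representation of the functionals `φ ∘ T`. -/
theorem exists_scalar_measure {T : C_c(X, ℝ) →ₗ[ℝ] E} (hT : IsPositiveOperator T)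
    (hE : IsOrderContinuousNorm E (fun e => ‖e‖)) {a : Set X → E}
    (ha : ∀ V, IsLUB (testValues T V) (a V)) {φ : E →L[ℝ] ℝ} (hφ : Monotone φ) :
    ∃ m : Measure X, IsFiniteMeasure m ∧ m.Regular ∧ (∀ f : C_c(X, ℝ), ∫ x, f x ∂m = φ (T f)) ∧
      ∀ V, IsOpen V → m.real V = φ (a V) := by
  let Λ : C_c(X, ℝ) →ₚ[ℝ] ℝ := PositiveLinearMap.mk₀ (φ.toLinearMap ∘ₗ T) fun f hf => by
    have := hφ (hT f hf)
    rwa [map_zero] at this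
  have hΛ : ∀ f, Λ f = φ (T f) := fun _ => rfl
  let m := RealRMK.rieszMeasure Λ
  -- By inner regularity of the scalar measure, `m V` is approached by `m K` for compact `K ⊆ V`,
  -- and a bump function between `K` and `V` is a test function for `V`.
  have hle : ∀ V, IsOpen V → ∀ u ∈ upperBounds (φ '' testValues T V),
      m V ≤ ENNReal.ofReal u := by
    intro V hV u hu
    rw [hV.measure_eq_iSup_isCompact]
    refine iSup₂_le fun K hKV => iSup_le fun hK => ?_
    obtain ⟨f, hf, hfK, hfV⟩ := exists_bump hK hV hKV
    refine (RealRMK.rieszMeasure_le_of_eq_one Λ (fun x => (hf x).1) hK hfK).trans ?_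
    exact ENNReal.ofReal_le_ofReal (hu ⟨_, ⟨f, hf, hfV, rfl⟩, rfl⟩)
  have hlub : ∀ V, IsLUB (φ '' testValues T V) (φ (a V)) := fun V =>
    isLUB_image_of_directedOn hE ⟨0, zero_mem_testValues V⟩ (directedOn_testValues hT V) (ha V) hφ
  have hfin : IsFiniteMeasure m :=
    ⟨(hle univ isOpen_univ _ (hlub univ).1).trans_lt ENNReal.ofReal_lt_top⟩
  have hint : ∀ f : C_c(X, ℝ), ∫ x, f x ∂m = φ (T f) := RealRMK.integral_rieszMeasure Λ
  refine ⟨m, hfin, inferInstance, hint, fun V hV => IsLUB.unique ⟨?_, fun u hu => ?_⟩ (hlub V)⟩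
  -- Vanishing off `V` is enough for a test function: it gives `f ≤ 1_V`, hence `∫ f ≤ m V`.
  · rintro _ ⟨_, ⟨f, hf, hfV, rfl⟩, rfl⟩
    rw [← hint, ← integral_indicator_one hV.measurableSet]
    refine integral_mono ((isBoundedMeasurable_compactlySupported f).integrable m)
      ((integrable_const (1 : ℝ)).indicator hV.measurableSet) fun x => ?_
    by_cases hx : x ∈ V
    · simpa [hx] using (hf x).2
    · simp [hx, hfV x hx]
  · refine ENNReal.toReal_le_of_le_ofReal ?_ (hle V hV u hu)
    have := hu ⟨0, zero_mem_testValues V, rfl⟩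
    rwa [map_zero] at this

/-- **Riesz representation** of positive operators. -/
theorem exists_representation_of_isPositiveOperator (hE : IsOrderContinuousNorm E (fun e => ‖e‖))
    {T : C_c(X, ℝ) →ₗ[ℝ] E} (hT : IsPositiveOperator T) (hn : IsNormToOrderBounded T) :
    ∃ ν : MSet X → E, IsPosRegularMeasure ν ∧ ∀ f : C_c(X, ℝ), realOrderIntegral ν f = T f := by
  -- The order bound of `T` on the unit ball dominates all test values, which gives the suprema `a
  -- V`.
  obtain ⟨e, he⟩ := hn {f | ∀ x, |f x| ≤ 1} ⟨1, fun f hf => hf⟩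
  have hexa : ∀ V : Set X, ∃ s, IsLUB (testValues T V) s := fun V =>
    exists_isLUB_of_bddAbove hE ⟨0, zero_mem_testValues V⟩ ⟨e, by
      rintro _ ⟨f, hf, -, rfl⟩
      exact (le_abs_self _).trans (he f fun x => by
        rw [abs_of_nonneg (hf x).1]
        exact (hf x).2)⟩
  choose a ha using hexa
  have ha0 : ∀ V, 0 ≤ a V := fun V => (ha V).1 (zero_mem_testValues V)
  have hamono : ∀ {V W : Set X}, V ⊆ W → a V ≤ a W := fun h =>
    isLUB_le_iff (ha _) |>.2 (upperBounds_mono_set (testValues_mono h) (ha _).1)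
  let S : MSet X → Set E := fun A => {e | ∃ V, IsOpen V ∧ A.1 ⊆ V ∧ a V = e}
  have hSne : ∀ A, (S A).Nonempty := fun A => ⟨_, univ, isOpen_univ, subset_univ _, rfl⟩
  have hexν : ∀ A : MSet X, ∃ s, IsGLB (S A) s := fun A =>
    exists_isGLB_of_bddBelow hE (hSne A) ⟨0, by
        rintro _ ⟨V, -, -, rfl⟩
        exact ha0 V⟩
  choose ν hν using hexν
  -- The one set function `ν` serves all `φ` at once: `φ ∘ ν` is the Riesz measure of `φ ∘ T`,
  -- because `φ` preserves the directed infimum over open supersets and the scalar measure is outer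
  -- regular.
  have hscal : ∀ φ : E →L[ℝ] ℝ, Monotone φ → ∃ m : Measure X, IsFiniteMeasure m ∧ m.Regular ∧
      (∀ f : C_c(X, ℝ), ∫ x, f x ∂m = φ (T f)) ∧ ∀ A : MSet X, m.real A.1 = φ (ν A) := by
    intro φ hφ
    obtain ⟨m, hfin, hreg, hint, hV⟩ := exists_scalar_measure hT hE ha hφ
    refine ⟨m, hfin, hreg, hint, fun A => IsGLB.unique ⟨?_, fun u hu => ?_⟩
      (isGLB_image_of_directedOn hE (hSne A) ?_ (hν A) hφ)⟩
    · rintro _ ⟨_, ⟨V, hVo, hAV, rfl⟩, rfl⟩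
      rw [← hV V hVo]
      exact measureReal_mono hAV
    · rw [measureReal_def, ← ENNReal.ofReal_le_iff_le_toReal (measure_ne_top m _),
        A.1.measure_eq_iInf_isOpen m]
      refine le_iInf₂ fun V hAV => le_iInf fun hVo => ?_
      rw [ENNReal.ofReal_le_iff_le_toReal (measure_ne_top m _)]
      exact (hu ⟨_, ⟨V, hVo, hAV, rfl⟩, rfl⟩).trans_eq (hV V hVo).symm
    · rintro _ ⟨V, hV, hAV, rfl⟩ _ ⟨W, hW, hAW, rfl⟩
      exact ⟨_, ⟨V ∩ W, hV.inter hW, subset_inter hAV hAW, rfl⟩, hamono inter_subset_left,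
        hamono inter_subset_right⟩
  have hpos : IsPosMeasure ν := by
    refine ⟨fun A => (hν A).2 ?_, ?_, fun A hA => ⟨?_, fun u hu => ?_⟩⟩
    · rintro _ ⟨V, -, -, rfl⟩
      exact ha0 V
    · refine eq_of_forall_monotone fun φ hφ => ?_
      obtain ⟨m, _, -, -, hm⟩ := hscal φ hφ
      rw [← hm, map_zero]
      exact measureReal_empty
    all_goals
      have key : ∀ {φ : E →L[ℝ] ℝ} {m : Measure X} [IsFiniteMeasure m],
          (∀ A : MSet X, m.real A.1 = φ (ν A)) → HasSum (fun i => φ (ν (A i)))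
            (φ (ν ⟨⋃ i, (A i).1, MeasurableSet.iUnion fun i => (A i).2⟩)) := by
        intro φ m _ hm
        simp only [← hm]
        have hd : m (⋃ i, (A i).1) = ∑' i, m (A i).1 :=
          measure_iUnion (fun i j hij => hA i j hij) fun i => (A i).2
        simp only [measureReal_def, hd]
        rw [ENNReal.tsum_toReal_eq fun i => measure_ne_top m _]
        exact ENNReal.hasSum_toReal (hd ▸ measure_ne_top m _)
    · rintro _ ⟨n, rfl⟩
      refine le_of_forall_monotone fun φ hφ => ?_
      obtain ⟨m, _, -, -, hm⟩ := hscal φ hφ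
      rw [map_sum]
      exact sum_le_hasSum _ (fun i _ => by rw [← hm]; exact measureReal_nonneg) (key hm)
    · refine le_of_forall_monotone fun φ hφ => ?_
      obtain ⟨m, _, -, -, hm⟩ := hscal φ hφ
      refine le_of_tendsto' (key hm).tendsto_sum_nat fun n => ?_
      rw [← map_sum]
      exact hφ (hu ⟨n, rfl⟩)
  have hreg : IsPosRegularMeasure ν := by
    refine ⟨hpos, fun V hV => ⟨?_, fun u hu => ?_⟩, fun A => ⟨?_, fun u hu => ?_⟩⟩
    · rintro _ ⟨K, -, hKV, rfl⟩
      exact hpos.isContent.mono hKV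
    -- An upper bound `u` of the values on compact sets gives `φ u ≥ m K` for all compact `K ⊆ V`,
    -- so scalar inner regularity applies.
    · refine le_of_forall_monotone fun φ hφ => ?_
      obtain ⟨m, _, _, -, hm⟩ := hscal φ hφ
      have hu0 : 0 ≤ φ u := by
        have := hφ (hu ⟨∅, by simp, by simp, rfl⟩)
        exact measureReal_nonneg.trans ((hm ∅).trans_le this)
      rw [← hm]
      refine ENNReal.toReal_le_of_le_ofReal hu0 ?_
      rw [hV.measure_eq_iSup_isCompact]
      refine iSup₂_le fun K hKV => iSup_le fun hK => ?_
      rw [ENNReal.le_ofReal_iff_toReal_le (measure_ne_top m _) hu0]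
      exact (hm ⟨K, hK.measurableSet⟩).trans_le (hφ (hu ⟨⟨K, hK.measurableSet⟩, hK, hKV, rfl⟩))
    · rintro _ ⟨V, -, hAV, rfl⟩
      exact hpos.isContent.mono hAV
    · refine le_of_forall_monotone fun φ hφ => ?_
      obtain ⟨m, _, _, -, hm⟩ := hscal φ hφ
      rw [← hm, measureReal_def, ← ENNReal.ofReal_le_iff_le_toReal (measure_ne_top m _),
        A.1.measure_eq_iInf_isOpen m]
      refine le_iInf₂ fun V hAV => le_iInf fun hVo => ?_
      rw [ENNReal.ofReal_le_iff_le_toReal (measure_ne_top m _)]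
      exact (hφ (hu ⟨⟨V, hVo.measurableSet⟩, hVo, hAV, rfl⟩)).trans_eq
        (hm ⟨V, hVo.measurableSet⟩).symm
  refine ⟨ν, hreg, fun f => eq_of_forall_monotone fun φ hφ => ?_⟩
  obtain ⟨m, _, -, hint, hm⟩ := hscal φ hφ
  rw [map_realOrderIntegral hE hpos (isBoundedMeasurable_compactlySupported f) hm, hint]

end Representation

/-! ### Positive parts and moduli of operators on `C_c(X)`. -/

section RieszKantorovich

variable {X : Type*} [TopologicalSpace X]
variable {E : Type*} [NormedAddCommGroup E] [NormedSpace ℝ E] [Lattice E] [IsOrderedAddMonoid E]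
  [HasSolidNorm E] [IsOrderedModule ℝ E] [CompleteSpace E]

/-- An additive and positively homogeneous map on the positive cone of `C_c(X)` extends to a linear
operator. -/
theorem exists_linearMap_of_additive {P : C_c(X, ℝ) → E}
    (hadd : ∀ f g, 0 ≤ f → 0 ≤ g → P (f + g) = P f + P g)
    (hsmul : ∀ (r : ℝ) f, 0 < r → 0 ≤ f → P (r • f) = r • P f) :
    ∃ T : C_c(X, ℝ) →ₗ[ℝ] E, (∀ f, 0 ≤ f → T f = P f) ∧ ∀ f, T f = P (f ⊔ 0) - P (-f ⊔ 0) := by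
  have hP0 : P 0 = 0 := by
    have := hadd 0 0 le_rfl le_rfl
    rwa [add_zero, left_eq_add] at this
  -- From `f = g - h` follows `f⁺ + h = g + f⁻`, so additivity makes `P g - P h` depend on `f`
  -- alone. Linearity is then read off from convenient decompositions.
  have hsub : ∀ {f g h : C_c(X, ℝ)}, 0 ≤ g → 0 ≤ h → f = g - h →
      P (f ⊔ 0) - P (-f ⊔ 0) = P g - P h := by
    intro f g h hg hh hf
    rw [sub_eq_sub_iff_add_eq_add, ← hadd _ _ le_sup_right hh, ← hadd _ _ hg le_sup_right]
    congr 1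
    ext x
    have := congrArg (fun k : C_c(X, ℝ) => k x) hf
    simp only [CompactlySupportedContinuousMap.sub_apply] at this
    simp only [CompactlySupportedContinuousMap.add_apply, CompactlySupportedContinuousMap.sup_apply,
      CompactlySupportedContinuousMap.zero_apply, CompactlySupportedContinuousMap.neg_apply]
    obtain h0 | h0 := le_total 0 (f x)
    · rw [sup_of_le_left h0, sup_of_le_right (neg_nonpos.2 h0)]
      linarith
    · rw [sup_of_le_right h0, sup_of_le_left (neg_nonneg.2 h0)]
      linarith
  have hdec : ∀ f : C_c(X, ℝ), f = f ⊔ 0 - (-f ⊔ 0) := by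
    intro f
    ext x
    simp only [CompactlySupportedContinuousMap.sub_apply, CompactlySupportedContinuousMap.sup_apply,
      CompactlySupportedContinuousMap.zero_apply, CompactlySupportedContinuousMap.neg_apply]
    obtain h0 | h0 := le_total 0 (f x)
    · rw [sup_of_le_left h0, sup_of_le_right (neg_nonpos.2 h0), sub_zero]
    · rw [sup_of_le_right h0, sup_of_le_left (neg_nonneg.2 h0), zero_sub, neg_neg]
  have hsm : ∀ {r : ℝ} {f : C_c(X, ℝ)}, 0 ≤ r → 0 ≤ f → 0 ≤ r • f := fun hr hf x =>
    mul_nonneg hr (hf x)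
  have hsmul' : ∀ (r : ℝ) f, 0 ≤ r → 0 ≤ f → P (r • f) = r • P f := by
    intro r f hr hf
    obtain rfl | hr := hr.eq_or_lt
    · rw [zero_smul, zero_smul, hP0]
    · exact hsmul r f hr hf
  refine ⟨⟨⟨fun f => P (f ⊔ 0) - P (-f ⊔ 0), fun f g => ?_⟩, fun r f => ?_⟩, fun f hf => ?_,
    fun f => rfl⟩
  · rw [hsub (g := f ⊔ 0 + g ⊔ 0) (h := (-f ⊔ 0) + (-g ⊔ 0)) (add_nonneg le_sup_right le_sup_right)
      (add_nonneg le_sup_right le_sup_right) (by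
        conv_lhs => rw [hdec f, hdec g]
        abel), hadd _ _ le_sup_right le_sup_right, hadd _ _ le_sup_right le_sup_right]
    abel
  · simp only [RingHom.id_apply]
    obtain hr | hr := le_total 0 r
    · rw [hsub (hsm hr (le_sup_right : 0 ≤ f ⊔ 0)) (hsm hr (le_sup_right : 0 ≤ -f ⊔ 0)) (by
        conv_lhs => rw [hdec f, smul_sub]), hsmul' _ _ hr le_sup_right,
        hsmul' _ _ hr le_sup_right, smul_sub]
    · have hr' := neg_nonneg.2 hr
      rw [hsub (hsm hr' (le_sup_right : 0 ≤ -f ⊔ 0)) (hsm hr' (le_sup_right : 0 ≤ f ⊔ 0)) (by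
        conv_lhs => rw [hdec f, smul_sub]
        ext x
        change r * _ - r * _ = -r * _ - -r * _
        ring), hsmul' _ _ hr' le_sup_right, hsmul' _ _ hr' le_sup_right, smul_sub, neg_smul,
        neg_smul]
      abel
  · change P (f ⊔ 0) - P (-f ⊔ 0) = P f
    rw [hsub hf le_rfl (sub_zero f).symm, hP0, sub_zero]

/-- Norm to order bounded operators on `C_c(X)` are differences of positive ones, with a sum that
is the smallest operator above `T` and `-T`. -/
theorem exists_positive_decomposition (hE : IsOrderContinuousNorm E (fun e => ‖e‖))
    {T : C_c(X, ℝ) →ₗ[ℝ] E} (hT : IsNormToOrderBounded T) :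
    ∃ T₁ T₂ : C_c(X, ℝ) →ₗ[ℝ] E, IsPositiveOperator T₁ ∧ IsPositiveOperator T₂ ∧
      IsNormToOrderBounded T₁ ∧ IsNormToOrderBounded T₂ ∧ T = T₁ - T₂ ∧
      ∀ S : C_c(X, ℝ) →ₗ[ℝ] E, (∀ f : C_c(X, ℝ), (∀ x, 0 ≤ f x) → T f ≤ S f ∧ -T f ≤ S f) →
        ∀ f : C_c(X, ℝ), (∀ x, 0 ≤ f x) → (T₁ + T₂) f ≤ S f := by
  let S : C_c(X, ℝ) → Set E := fun f => {e | ∃ g : C_c(X, ℝ), 0 ≤ g ∧ g ≤ f ∧ T g = e}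
  have hSle : ∀ {c : ℝ} {e : E}, (∀ f ∈ {f : C_c(X, ℝ) | ∀ x, |f x| ≤ c}, |T f| ≤ e) →
      ∀ f : C_c(X, ℝ), (∀ x, f x ≤ c) → e ∈ upperBounds (S f) := by
    rintro c e he f hf _ ⟨g, hg, hgf, rfl⟩
    refine (le_abs_self _).trans (he g fun x => ?_)
    rw [abs_of_nonneg (hg x)]
    exact (hgf x).trans (hf x)
  have hbound : ∀ f : C_c(X, ℝ), ∃ c : ℝ, ∀ x, |f x| ≤ c := fun f => by
    obtain ⟨c, hc⟩ := f.hasCompactSupport.exists_bound_of_continuous f.continuous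
    exact ⟨c, fun x => by simpa using hc x⟩
  -- The value at an `f` that is not positive is arbitrary; only the cone matters for the extension.
  have hex : ∀ f : C_c(X, ℝ), ∃ s, 0 ≤ f → IsLUB (S f) s := by
    intro f
    by_cases hf : 0 ≤ f
    · obtain ⟨c, hc⟩ := hbound f
      obtain ⟨e, he⟩ := hT {f | ∀ x, |f x| ≤ c} ⟨c, fun f hf => hf⟩
      obtain ⟨s, hs⟩ := exists_isLUB_of_bddAbove hE (S := S f) ⟨_, 0, le_rfl, hf, rfl⟩
        ⟨e, hSle he f fun x => (le_abs_self _).trans (hc x)⟩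
      exact ⟨s, fun _ => hs⟩
    · exact ⟨0, fun h => absurd h hf⟩
  choose P hP using hex
  obtain ⟨T₁, hT₁, hT₁'⟩ := exists_linearMap_of_additive (P := P) (fun f g hf hg => by
      refine (hP _ (add_nonneg hf hg)).unique ?_
      have hadd := (hP f hf).add (hP g hg)
      have hS : S f + S g = S (f + g) := by
        ext e
        constructor
        · rintro ⟨_, ⟨u, hu, huf, rfl⟩, _, ⟨v, hv, hvg, rfl⟩, rfl⟩
          exact ⟨u + v, add_nonneg hu hv, add_le_add huf hvg, map_add _ _ _⟩
        · rintro ⟨u, hu, hufg, rfl⟩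
          -- Riesz decomposition: `0 ≤ u ≤ f + g` splits as `u ⊓ f` below `f` and the remainder
          -- below `g`.
          refine ⟨_, ⟨u ⊓ f, le_inf hu hf, inf_le_right, rfl⟩, _,
            ⟨u - u ⊓ f, sub_nonneg.2 inf_le_left, fun x => ?_, rfl⟩, ?_⟩
          · have h1 : u x ≤ f x + g x := hufg x
            have h2 : 0 ≤ g x := hg x
            change u x - min (u x) (f x) ≤ g x
            obtain h | h := le_total (u x) (f x)
            · rw [min_eq_left h]
              linarith
            · rw [min_eq_right h]
              linarith
          · simp only
            rw [← map_add, add_sub_cancel]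
      rwa [hS] at hadd) (fun r f hr hf => by
      have hrf : 0 ≤ r • f := fun x => mul_nonneg hr.le (hf x)
      refine (hP _ hrf).unique ?_
      have := (OrderIso.smulRight hr (β := E)).isLUB_image'.2 (hP f hf)
      convert this using 1
      swap
      · rfl
      ext e
      constructor
      · rintro ⟨g, hg, hgf, rfl⟩
        refine ⟨T (r⁻¹ • g), ⟨r⁻¹ • g, fun x => mul_nonneg (inv_nonneg.2 hr.le) (hg x),
          fun x => (inv_mul_le_iff₀ hr).2 (hgf x), rfl⟩, ?_⟩
        rw [map_smul]
        exact smul_inv_smul₀ hr.ne' _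
      · rintro ⟨_, ⟨g, hg, hgf, rfl⟩, rfl⟩
        exact ⟨r • g, fun x => mul_nonneg hr.le (hg x),
          fun x => mul_le_mul_of_nonneg_left (hgf x) hr.le, map_smul _ _ _⟩)
  have hP0 : ∀ f, 0 ≤ f → 0 ≤ P f := fun f hf => (hP f hf).1 ⟨0, le_rfl, hf, map_zero T⟩
  have hn : IsNormToOrderBounded T₁ := by
    rintro D ⟨c, hc⟩
    obtain ⟨e, he⟩ := hT {f | ∀ x, |f x| ≤ c} ⟨c, fun f hf => hf⟩
    have hPle : ∀ f : C_c(X, ℝ), (∀ x, |f x| ≤ c) → |P (f ⊔ 0)| ≤ e := by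
      intro f hf
      rw [abs_of_nonneg (hP0 _ le_sup_right)]
      exact (hP _ le_sup_right).2 (hSle he _ fun x =>
        sup_le ((le_abs_self _).trans (hf x)) ((abs_nonneg _).trans (hf x)))
    refine ⟨e + e, fun f hf => ?_⟩
    rw [hT₁', sub_eq_add_neg]
    refine (abs_add_le _ _).trans (add_le_add (hPle f (hc f hf)) ?_)
    rw [abs_neg]
    exact hPle (-f) fun x => by
      rw [CompactlySupportedContinuousMap.neg_apply, abs_neg]
      exact hc f hf x
  refine ⟨T₁, T₁ - T, fun f hf => ?_, fun f hf => ?_, hn,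
    (nobOperators C_c(X, ℝ) E).sub_mem hn hT, by abel,
    fun R hR f hf => ?_⟩
  · rw [hT₁ f hf]
    exact hP0 f hf
  · rw [LinearMap.sub_apply, hT₁ f hf]
    exact sub_nonneg.2 ((hP f hf).1 ⟨f, hf, le_rfl, rfl⟩)
  · have hRT : IsPositiveOperator (R + T) := fun f hf => neg_le_iff_add_nonneg.1 (hR f hf).2
    have hle : P f + P f ≤ R f + T f := ((hP f hf).add (hP f hf)).2 (by
      rintro _ ⟨_, ⟨g, hg, hgf, rfl⟩, _, ⟨h, hh, hhf, rfl⟩, rfl⟩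
      -- Here `2 T g ≤ R g + T g ≤ R f + T f`, since `R + T` is positive. Averaging over `g` and `h`
      -- and taking suprema gives `2 T₁ f ≤ R f + T f`, that is `(T₁ + T₂) f ≤ R f` with `T₂ = T₁ -
      -- T`.
      have h1 : ∀ g : C_c(X, ℝ), 0 ≤ g → g ≤ f → T g + T g ≤ R f + T f := fun g hg hgf =>
        (add_le_add_left (hR g hg).1 _).trans
          (hRT.mono (fun _ _ _ => rfl) fun x => hgf x)
      have h2 := add_le_add (h1 g hg hgf) (h1 h hh hhf)
      have h3 : (2 : ℝ) • (T g + T h) ≤ (2 : ℝ) • (R f + T f) := by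
        rw [two_smul, two_smul]
        refine le_of_eq_of_le ?_ h2
        abel
      exact (smul_le_smul_iff_of_pos_left two_pos).1 h3)
    rw [LinearMap.add_apply, LinearMap.sub_apply, hT₁ f hf, ← add_sub_assoc, sub_le_iff_le_add]
    exact hle

end RieszKantorovich

/-! ### Transport of Banach lattice properties along isometric lattice isomorphisms. -/

section Transfer

variable {V W : Type*} [AddCommGroup V] [Module ℝ V] [Preorder V] [AddCommGroup W] [Module ℝ W]
  [Preorder W] {N : V → ℝ} {N' : W → ℝ} {Φ : V ≃ₗ[ℝ] W}

theorem IsIsometricLatticeIso.of_le_iff (h : ∀ u v, Φ u ≤ Φ v ↔ u ≤ v)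
    (hN : ∀ v, N' (Φ v) = N v) : IsIsometricLatticeIso N N' Φ where
  map_le_map_iff := h
  map_sup u v s hs := by
    have := OrderIso.isLUB_image' (⟨Φ.toEquiv, h _ _⟩ : V ≃o W) |>.2 hs
    rwa [image_pair] at this
  map_inf u v s hs := by
    have := OrderIso.isGLB_image' (⟨Φ.toEquiv, h _ _⟩ : V ≃o W) |>.2 hs
    rwa [image_pair] at this
  isometric := hN

namespace IsIsometricLatticeIso

theorem symm (h : IsIsometricLatticeIso N N' Φ) : IsIsometricLatticeIso N' N Φ.symm :=
  .of_le_iff (fun u v => by rw [← h.map_le_map_iff, Φ.apply_symm_apply, Φ.apply_symm_apply])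
    fun v => by rw [← h.isometric, Φ.apply_symm_apply]

theorem nonneg_iff (h : IsIsometricLatticeIso N N' Φ) {v : V} : 0 ≤ Φ v ↔ 0 ≤ v := by
  rw [← h.map_le_map_iff, map_zero]

theorem isBanachLattice (h : IsIsometricLatticeIso N N' Φ) (hV : IsBanachLattice V N) :
    IsBanachLattice W N' := by
  have hle : ∀ {u v}, Φ.symm u ≤ Φ.symm v ↔ u ≤ v := fun {u v} => h.symm.map_le_map_iff u v
  have hN : ∀ w, N' w = N (Φ.symm w) := fun w => (h.symm.isometric w).symm
  have hneg : ∀ u a, IsLUB {u, -u} a → IsLUB {Φ.symm u, -Φ.symm u} (Φ.symm a) := fun u a ha => by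
    rw [← map_neg]
    exact h.symm.map_sup _ _ _ ha
  refine ⟨fun u v h1 h2 => Φ.symm.injective (hV.le_antisymm _ _ (hle.2 h1) (hle.2 h2)),
    fun u v w huv => ?_, fun r v hr hv => ?_, fun u v => ?_, fun u v => ?_, fun v => ?_,
    fun v => ?_, fun r v => ?_, fun u v => ?_, fun u v a b ha hb hab => ?_, fun x hx => ?_⟩
  · rw [← hle, map_add, map_add]
    exact hV.add_le_add_right _ _ _ (hle.2 huv)
  · rw [← h.symm.nonneg_iff, map_smul]
    exact hV.smul_nonneg r _ hr (h.symm.nonneg_iff.2 hv)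
  · obtain ⟨s, hs⟩ := hV.exists_sup (Φ.symm u) (Φ.symm v)
    exact ⟨Φ s, by simpa using h.map_sup _ _ _ hs⟩
  · obtain ⟨s, hs⟩ := hV.exists_inf (Φ.symm u) (Φ.symm v)
    exact ⟨Φ s, by simpa using h.map_inf _ _ _ hs⟩
  · rw [hN]
    exact hV.norm_nonneg _
  · rw [hN, hV.norm_eq_zero, LinearEquiv.map_eq_zero_iff]
  · rw [hN, hN, map_smul, hV.norm_smul]
  · rw [hN, hN, hN, map_add]
    exact hV.norm_add_le _ _
  · rw [hN, hN]
    exact hV.norm_solid _ _ _ _ (hneg u a ha) (hneg v b hb) (hle.2 hab)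
  · obtain ⟨v, hv⟩ := hV.complete (fun n => Φ.symm (x n)) (by simpa only [hN, map_sub] using hx)
    exact ⟨Φ v, by simpa only [hN, map_sub, Φ.symm_apply_apply] using hv⟩

theorem isALNorm (h : IsIsometricLatticeIso N N' Φ) (hV : IsALNorm V N) : IsALNorm W N' :=
  fun u v hu hv => by
    rw [← h.symm.isometric, ← h.symm.isometric u, ← h.symm.isometric v, map_add]
    exact hV _ _ (h.symm.nonneg_iff.2 hu) (h.symm.nonneg_iff.2 hv)

theorem isALNorm_iff (h : IsIsometricLatticeIso N N' Φ) : IsALNorm W N' ↔ IsALNorm V N :=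
  ⟨h.symm.isALNorm, h.isALNorm⟩

theorem image_directed (h : IsIsometricLatticeIso N N' Φ) {D : Set V}
    (hdir : DirectedOn (· ≤ ·) D) (hD : ∀ v ∈ D, 0 ≤ v) (hbdd : ∃ C : ℝ, ∀ v ∈ D, N v ≤ C) :
    DirectedOn (· ≤ ·) (Φ '' D) ∧ (∀ w ∈ Φ '' D, 0 ≤ w) ∧ ∃ C : ℝ, ∀ w ∈ Φ '' D, N' w ≤ C := by
  refine ⟨?_, ?_, ?_⟩
  · rintro _ ⟨a, ha, rfl⟩ _ ⟨b, hb, rfl⟩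
    obtain ⟨c, hc, h1, h2⟩ := hdir a ha b hb
    exact ⟨_, ⟨c, hc, rfl⟩, (h.map_le_map_iff _ _).2 h1, (h.map_le_map_iff _ _).2 h2⟩
  · rintro _ ⟨a, ha, rfl⟩
    exact h.nonneg_iff.2 (hD a ha)
  · obtain ⟨C, hC⟩ := hbdd
    refine ⟨C, ?_⟩
    rintro _ ⟨a, ha, rfl⟩
    rw [h.isometric]
    exact hC a ha

theorem isLeviNorm (h : IsIsometricLatticeIso N N' Φ) (hW : IsLeviNorm W N') :
    IsLeviNorm V N := by
  intro D hne hdir hD hbdd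
  obtain ⟨h1, h2, h3⟩ := h.image_directed hdir hD hbdd
  obtain ⟨s, hs⟩ := hW _ (hne.image Φ) h1 h2 h3
  refine ⟨Φ.symm s, fun d hd => ?_, fun u hu => ?_⟩
  · rw [← h.map_le_map_iff, Φ.apply_symm_apply]
    exact hs.1 ⟨d, hd, rfl⟩
  · rw [← h.map_le_map_iff, Φ.apply_symm_apply]
    refine hs.2 ?_
    rintro _ ⟨d, hd, rfl⟩
    exact (h.map_le_map_iff _ _).2 (hu hd)

theorem isLeviNorm_iff (h : IsIsometricLatticeIso N N' Φ) : IsLeviNorm W N' ↔ IsLeviNorm V N :=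
  ⟨h.isLeviNorm, h.symm.isLeviNorm⟩

theorem isKBNorm (h : IsIsometricLatticeIso N N' Φ) (hW : IsKBNorm W N') : IsKBNorm V N := by
  intro D hne hdir hD hbdd
  obtain ⟨h1, h2, h3⟩ := h.image_directed hdir hD hbdd
  obtain ⟨s, hs⟩ := hW _ (hne.image Φ) h1 h2 h3
  refine ⟨Φ.symm s, fun ε hε => ?_⟩
  obtain ⟨_, ⟨d, hd, rfl⟩, hlt⟩ := hs ε hε
  refine ⟨d, hd, fun d' hd' hdd => ?_⟩
  rw [← h.isometric, map_sub, Φ.apply_symm_apply]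
  exact hlt _ ⟨d', hd', rfl⟩ ((h.map_le_map_iff _ _).2 hdd)

theorem isKBNorm_iff (h : IsIsometricLatticeIso N N' Φ) : IsKBNorm W N' ↔ IsKBNorm V N :=
  ⟨h.isKBNorm, h.symm.isKBNorm⟩

end IsIsometricLatticeIso

end Transfer

/-! ### A common framework for `C_c(X)` and `C₀(X)`. -/

section FunctionSpaces

variable {X : Type*} [TopologicalSpace X]

/-- `F` is a space of bounded continuous functions in which `C_c(X)` is dense. -/
structure IsFunctionSpace {F : Type*} [AddCommGroup F] [Module ℝ F] [FunLike F X ℝ]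
    (j : C_c(X, ℝ) →ₗ[ℝ] F) : Prop where
  add_apply : ∀ (f g : F) x, (f + g) x = f x + g x
  smul_apply : ∀ (r : ℝ) (f : F) x, (r • f) x = r * f x
  apply_eq : ∀ f x, j f x = f x
  continuous : ∀ f : F, Continuous f
  bounded : ∀ f : F, ∃ c : ℝ, ∀ x, |f x| ≤ c
  exists_approx : ∀ (f : F) (ε : ℝ), 0 < ε → ∃ g : C_c(X, ℝ), ∀ x, |f x - g x| ≤ ε

theorem isFunctionSpace_compactlySupported :
    IsFunctionSpace (LinearMap.id : C_c(X, ℝ) →ₗ[ℝ] C_c(X, ℝ)) where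
  add_apply _ _ _ := rfl
  smul_apply _ _ _ := rfl
  apply_eq _ _ := rfl
  continuous f := f.continuous
  bounded f := by
    obtain ⟨c, hc⟩ := f.hasCompactSupport.exists_bound_of_continuous f.continuous
    exact ⟨c, fun x => by simpa using hc x⟩
  exists_approx f ε hε := ⟨f, fun x => by simpa using hε.le⟩

/-- The inclusion of `C_c(X)` in `C₀(X)`. -/
def compactlySupportedToZeroAtInfty : C_c(X, ℝ) →ₗ[ℝ] C₀(X, ℝ) where
  toFun f := ⟨f.toContinuousMap, zero_at_infty f⟩
  map_add' _ _ := rfl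
  map_smul' _ _ := rfl

/-- Truncation near zero: a function vanishing at infinity is approximated by compactly supported
functions. -/
theorem exists_compactlySupported_approx [T2Space X] (f : C₀(X, ℝ)) {ε : ℝ} (hε : 0 < ε) :
    ∃ g : C_c(X, ℝ), ∀ x, |f x - g x| ≤ ε := by
  -- Soft thresholding: the values of `f` are moved towards `0` by `ε` and vanish where `|f| < ε`,
  -- so off a compact set.
  have hcpt : HasCompactSupport fun x => max (f x - ε) 0 - max (-f x - ε) 0 := by
    have h := (zero_at_infty f).eventually (Metric.ball_mem_nhds 0 hε)
    obtain ⟨K, hK, hKf⟩ := mem_cocompact.1 h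
    refine HasCompactSupport.of_support_subset_isCompact hK fun x hx => ?_
    by_contra hxK
    have : |f x| < ε := by simpa using hKf hxK
    rw [abs_lt] at this
    refine hx ?_
    simp only
    rw [max_eq_right (by linarith), max_eq_right (by linarith), sub_zero]
  refine ⟨⟨⟨_, by fun_prop⟩, hcpt⟩, fun x => ?_⟩
  change |f x - (max (f x - ε) 0 - max (-f x - ε) 0)| ≤ ε
  rw [abs_le]
  obtain h1 | h1 := le_total (f x - ε) 0 <;> obtain h2 | h2 := le_total (-f x - ε) 0 <;>
    simp only [max_eq_right, max_eq_left, h1, h2] <;> constructor <;> linarith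

theorem isFunctionSpace_zeroAtInfty [T2Space X] :
    IsFunctionSpace (compactlySupportedToZeroAtInfty : C_c(X, ℝ) →ₗ[ℝ] C₀(X, ℝ)) where
  add_apply _ _ _ := rfl
  smul_apply _ _ _ := rfl
  apply_eq _ _ := rfl
  continuous f := f.continuous
  bounded f := by
    refine ⟨‖f‖, fun x => ?_⟩
    rw [← f.norm_toBCF_eq_norm]
    exact f.toBCF.norm_coe_le_norm x
  exists_approx f ε hε := exists_compactlySupported_approx f hε

end FunctionSpaces

/-! ### Integration as an isometric lattice isomorphism. -/

section Isomorphism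

variable {X : Type*} [TopologicalSpace X] [MeasurableSpace X] [BorelSpace X] [T2Space X]
variable {F : Type*} [AddCommGroup F] [Module ℝ F] [FunLike F X ℝ] {j : C_c(X, ℝ) →ₗ[ℝ] F}
variable {E : Type*} [NormedAddCommGroup E] [NormedSpace ℝ E] [Lattice E] [IsOrderedAddMonoid E]
  [HasSolidNorm E] [IsOrderedModule ℝ E] [CompleteSpace E]

theorem IsFunctionSpace.isBoundedMeasurable (hF : IsFunctionSpace j) (f : F) :
    IsBoundedMeasurable f :=
  ⟨(hF.continuous f).measurable, hF.bounded f⟩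

variable (hE : IsOrderContinuousNorm E (fun e => ‖e‖))
include hE

theorem regularOrderIntegral_eq {μ : regularMeasures X E} {ν ξ : MSet X → E}
    (h : IsPosRegularMeasure ν) (k : IsPosRegularMeasure ξ) (hμ : μ.1 = ν - ξ) {f : X → ℝ}
    (hf : IsBoundedMeasurable f) :
    regularOrderIntegral μ f = realOrderIntegral ν f - realOrderIntegral ξ f :=
  orderIntegral_eq hE h.toIsPosMeasure k.toIsPosMeasure hμ hf

theorem regularOrderIntegral_of_nonneg {μ : regularMeasures X E} (hμ : 0 ≤ μ) {f : X → ℝ}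
    (hf : IsBoundedMeasurable f) : regularOrderIntegral μ f = realOrderIntegral μ.1 f := by
  have h := isPosRegularMeasure_of_nonneg hE hμ
  have hz := realOrderIntegral_add hE (IsPosMeasure.zero (X := X) (E := E)) .zero hf
  rw [add_zero, left_eq_add] at hz
  rw [regularOrderIntegral_eq hE h .zero (sub_zero _).symm hf, hz, sub_zero]

variable (E) in
/-- Integration of the functions in `F`, as a linear map on the regular measures. -/
noncomputable def integrationMap (hF : IsFunctionSpace j) :
    regularMeasures X E →ₗ[ℝ] nobOperators F E where
  toFun μ := ⟨
    { toFun := fun f => regularOrderIntegral μ f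
      map_add' := fun f g => by
        obtain ⟨ν, ξ, h, k, hμ⟩ := exists_regular_decomposition hE μ.2
        have hf := hF.isBoundedMeasurable f
        have hg := hF.isBoundedMeasurable g
        simp only [regularOrderIntegral_eq hE h k hμ (hF.isBoundedMeasurable _)]
        rw [show ⇑(f + g) = fun x => f x + g x from funext (hF.add_apply f g),
          h.realOrderIntegral_fun_add hE hf hg, k.realOrderIntegral_fun_add hE hf hg]
        abel
      map_smul' := fun r f => by
        obtain ⟨ν, ξ, h, k, hμ⟩ := exists_regular_decomposition hE μ.2
        have hf := hF.isBoundedMeasurable f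
        simp only [regularOrderIntegral_eq hE h k hμ (hF.isBoundedMeasurable _)]
        rw [show ⇑(r • f) = fun x => r * f x from funext (hF.smul_apply r f),
          h.realOrderIntegral_fun_smul hE hf, k.realOrderIntegral_fun_smul hE hf, ← smul_sub]
        rfl }, by
    rintro S ⟨c, hc⟩
    obtain ⟨ν, ξ, h, k, hμ⟩ := exists_regular_decomposition hE μ.2
    refine ⟨c • ν ⊤ + c • ξ ⊤, fun f hf => ?_⟩
    change |regularOrderIntegral μ f| ≤ _
    rw [regularOrderIntegral_eq hE h k hμ (hF.isBoundedMeasurable f), sub_eq_add_neg]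
    refine (abs_add_le _ _).trans ?_
    rw [abs_neg]
    exact add_le_add (h.abs_realOrderIntegral_le hE (hF.isBoundedMeasurable f) (hc f hf))
      (k.abs_realOrderIntegral_le hE (hF.isBoundedMeasurable f) (hc f hf))⟩
  map_add' μ ρ := Subtype.ext (LinearMap.ext fun f => by
    obtain ⟨ν, ξ, h, k, hμ⟩ := exists_regular_decomposition hE μ.2
    obtain ⟨ν', ξ', h', k', hρ⟩ := exists_regular_decomposition hE ρ.2
    have hf := hF.isBoundedMeasurable f
    change regularOrderIntegral (μ + ρ) f = regularOrderIntegral μ f + regularOrderIntegral ρ f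
    rw [regularOrderIntegral_eq hE (h.add hE h') (k.add hE k') (by
      rw [Submodule.coe_add, hμ, hρ]
      abel) hf, regularOrderIntegral_eq hE h k hμ hf, regularOrderIntegral_eq hE h' k' hρ hf,
      realOrderIntegral_add hE h.toIsPosMeasure h'.toIsPosMeasure hf,
      realOrderIntegral_add hE k.toIsPosMeasure k'.toIsPosMeasure hf]
    abel)
  map_smul' r μ := Subtype.ext (LinearMap.ext fun f => by
    obtain ⟨ν, ξ, h, k, hμ⟩ := exists_regular_decomposition hE μ.2
    have hf := hF.isBoundedMeasurable f
    change regularOrderIntegral (r • μ) f = r • regularOrderIntegral μ f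
    rw [regularOrderIntegral_eq hE h k hμ hf]
    obtain hr | hr := le_total 0 r
    · rw [regularOrderIntegral_eq hE (h.smul hE hr) (k.smul hE hr) (by
        rw [Submodule.coe_smul, hμ, smul_sub]) hf,
        realOrderIntegral_smul hE h.toIsPosMeasure hr hf,
        realOrderIntegral_smul hE k.toIsPosMeasure hr hf, smul_sub]
    · have hr' := neg_nonneg.2 hr
      rw [regularOrderIntegral_eq hE (k.smul hE hr') (h.smul hE hr') (by
        rw [Submodule.coe_smul, hμ, smul_sub, neg_smul, neg_smul]
        abel) hf,
        realOrderIntegral_smul hE k.toIsPosMeasure hr' hf,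
        realOrderIntegral_smul hE h.toIsPosMeasure hr' hf, smul_sub, neg_smul, neg_smul]
      abel)

theorem integrationMap_apply (hF : IsFunctionSpace j) (μ : regularMeasures X E) (f : F) :
    (integrationMap E hE hF μ).1 f = regularOrderIntegral μ f := rfl

theorem integrationMap_mono (hF : IsFunctionSpace j) {μ ρ : regularMeasures X E} (h : μ ≤ ρ) :
    integrationMap E hE hF μ ≤ integrationMap E hE hF ρ := by
  intro f hf
  rw [← sub_nonneg, ← LinearMap.sub_apply, ← Submodule.coe_sub, ← map_sub, integrationMap_apply,
    regularOrderIntegral_of_nonneg hE (sub_nonneg.2 h) (hF.isBoundedMeasurable f)]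
  have hpos := (isPosRegularMeasure_of_nonneg hE (sub_nonneg.2 h)).toIsPosMeasure
  have h0 : IsBoundedMeasurable (fun _ : X => (0 : ℝ)) := ⟨measurable_const, 0, by simp⟩
  have := hpos.realOrderIntegral_mono hE h0 (hF.isBoundedMeasurable f) hf
  have hz := hpos.realOrderIntegral_fun_smul hE h0 0
  simp only [mul_zero, zero_smul] at hz
  rwa [hz] at this

variable [LocallyCompactSpace X]

/-- A regular measure is approximated from within by integrals of compactly supported functions. -/
theorem IsPosRegularMeasure.exists_le_realOrderIntegral {ν : MSet X → E}
    (h : IsPosRegularMeasure ν) {K V : MSet X} (hK : IsCompact K.1) (hV : IsOpen V.1)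
    (hKV : K.1 ⊆ V.1) :
    ∃ f : C_c(X, ℝ), (∀ x, 0 ≤ f x ∧ f x ≤ 1) ∧ ν K ≤ realOrderIntegral ν f ∧
      ∀ ξ : MSet X → E, IsPosMeasure ξ → realOrderIntegral ξ f ≤ ξ V := by
  obtain ⟨f, hf, hfK, hfV⟩ := exists_bump hK hV hKV
  have hfm := isBoundedMeasurable_compactlySupported f
  have hind : ∀ A : MSet X, IsBoundedMeasurable (A.1.indicator (1 : X → ℝ)) := fun A =>
    ⟨measurable_one.indicator A.2, 1, fun x => by by_cases hx : x ∈ A.1 <;> simp [hx]⟩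
  refine ⟨f, hf, ?_, fun ξ hξ => ?_⟩
  · rw [← h.realOrderIntegral_indicator hE]
    refine h.realOrderIntegral_mono hE (hind K) hfm fun x => ?_
    by_cases hx : x ∈ K.1
    · simp [hx, hfK x hx]
    · simpa [hx] using (hf x).1
  · rw [← hξ.realOrderIntegral_indicator hE]
    refine hξ.realOrderIntegral_mono hE hfm (hind V) fun x => ?_
    by_cases hx : x ∈ V.1
    · simpa [hx] using (hf x).2
    · simp [hx, hfV x hx]

/-- For compact `K` in open `V` a bump function gives `ν K ≤ ∫ f dν ≤ ∫ f dξ ≤ ξ V`. Inner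
regularity of `ν` yields the inequality on open sets, outer regularity of `ξ` on all Borel sets. -/
theorem IsPosRegularMeasure.le_of_realOrderIntegral_le {ν ξ : MSet X → E}
    (h : IsPosRegularMeasure ν) (k : IsPosRegularMeasure ξ)
    (hle : ∀ f : C_c(X, ℝ), (∀ x, 0 ≤ f x) → realOrderIntegral ν f ≤ realOrderIntegral ξ f) :
    ν ≤ ξ := by
  have hopen : ∀ V : MSet X, IsOpen V.1 → ν V ≤ ξ V := fun V hV => (h.innerRegular V hV).2 (by
    rintro _ ⟨K, hK, hKV, rfl⟩
    obtain ⟨f, hf, h1, h2⟩ := h.exists_le_realOrderIntegral hE hK hV hKV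
    exact (h1.trans (hle f fun x => (hf x).1)).trans (h2 ξ k.toIsPosMeasure))
  refine fun A => (k.outerRegular A).2 ?_
  rintro _ ⟨V, hV, hAV, rfl⟩
  exact (h.toIsPosMeasure.isContent.mono hAV).trans (hopen V hV)

/-- Moving the subtracted measures across reduces the order comparison to the positive regular
measures `ν + ξ'` and `ν' + ξ`, for which functions in `C_c(X)` suffice. -/
theorem integrationMap_le_iff (hF : IsFunctionSpace j) (μ ρ : regularMeasures X E) :
    integrationMap E hE hF μ ≤ integrationMap E hE hF ρ ↔ μ ≤ ρ := by
  refine ⟨fun hle => ?_, integrationMap_mono hE hF⟩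
  obtain ⟨ν, ξ, h, k, hμ⟩ := exists_regular_decomposition hE μ.2
  obtain ⟨ν', ξ', h', k', hρ⟩ := exists_regular_decomposition hE ρ.2
  have key : ν + ξ' ≤ ν' + ξ :=
    (h.add hE k').le_of_realOrderIntegral_le hE (h'.add hE k) fun f hf => by
      have hfm := isBoundedMeasurable_compactlySupported f
      have := hle (j f) fun x => by
        rw [hF.apply_eq]
        exact hf x
      rw [integrationMap_apply, integrationMap_apply, show ⇑(j f) = f from funext (hF.apply_eq f),
        regularOrderIntegral_eq hE h k hμ hfm, regularOrderIntegral_eq hE h' k' hρ hfm,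
        sub_le_sub_iff] at this
      rwa [realOrderIntegral_add hE h.toIsPosMeasure k'.toIsPosMeasure hfm,
        realOrderIntegral_add hE h'.toIsPosMeasure k.toIsPosMeasure hfm]
  change μ.1 ≤ ρ.1
  rw [hμ, hρ]
  exact sub_le_sub_iff.2 key

omit hE [MeasurableSpace X] [BorelSpace X] [T2Space X] [LocallyCompactSpace X] in
theorem IsNormToOrderBounded.comp_inclusion (hF : IsFunctionSpace j) {T : F →ₗ[ℝ] E}
    (hT : IsNormToOrderBounded T) : IsNormToOrderBounded (T ∘ₗ j) := by
  rintro S ⟨c, hc⟩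
  obtain ⟨e, he⟩ := hT (j '' S) ⟨c, by
    rintro _ ⟨f, hf, rfl⟩ x
    rw [hF.apply_eq]
    exact hc f hf x⟩
  exact ⟨e, fun f hf => he _ ⟨f, hf, rfl⟩⟩

omit hE [MeasurableSpace X] [BorelSpace X] [T2Space X] [LocallyCompactSpace X] in
/-- A norm to order bounded operator that vanishes on `C_c(X)` is zero. -/
theorem IsNormToOrderBounded.eq_zero (hF : IsFunctionSpace j) {T : F →ₗ[ℝ] E}
    (hT : IsNormToOrderBounded T) (h0 : ∀ g, T (j g) = 0) : T = 0 := by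
  ext f
  obtain ⟨e, he⟩ := hT {f | ∀ x, |f x| ≤ 1} ⟨1, fun f hf => hf⟩
  -- If `g` in `C_c(X)` is uniformly `ε`-close to `f`, then `(f - g) / ε` lies in the unit ball and
  -- `T` maps it to `T f / ε`, so `|T f| ≤ ε e`.
  have key : ∀ ε > 0, ‖T f‖ ≤ ε * ‖e‖ := by
    intro ε hε
    obtain ⟨g, hg⟩ := hF.exists_approx f ε hε
    have h1 : T (ε⁻¹ • (f + (-1 : ℝ) • j g)) = ε⁻¹ • T f := by
      rw [map_smul, map_add, map_smul, h0, smul_zero, add_zero]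
    have h2 := he (ε⁻¹ • (f + (-1 : ℝ) • j g)) fun x => by
      rw [hF.smul_apply, hF.add_apply, hF.smul_apply, hF.apply_eq, abs_mul, abs_of_pos (by positivity),
        inv_mul_le_iff₀ hε, mul_one, neg_one_mul, ← sub_eq_add_neg]
      exact hg x
    have h3 : ‖ε⁻¹ • T f‖ ≤ ‖e‖ := by
      rw [← h1]
      exact norm_le_norm_of_abs_le_abs (h2.trans (le_abs_self e))
    rwa [norm_smul, norm_inv, Real.norm_of_nonneg hε.le, inv_mul_le_iff₀ hε] at h3
  refine norm_le_zero_iff.1 (le_of_forall_pos_le_add fun δ hδ => ?_)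
  refine (key (δ / (‖e‖ + 1)) (by positivity)).trans ?_
  rw [zero_add, div_mul_eq_mul_div, div_le_iff₀ (by positivity)]
  nlinarith [norm_nonneg e]

/-- Restrict to `C_c(X)`, split into positive operators and represent each. The resulting integral
agrees with `T` on `C_c(X)`, hence on `F` by `IsNormToOrderBounded.eq_zero`. -/
theorem integrationMap_surjective (hF : IsFunctionSpace j) :
    Function.Surjective (integrationMap E hE hF) := by
  intro T
  obtain ⟨T₁, T₂, p₁, p₂, b₁, b₂, hT, -⟩ :=
    exists_positive_decomposition hE (IsNormToOrderBounded.comp_inclusion hF T.2)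
  obtain ⟨ν, h, hν⟩ := exists_representation_of_isPositiveOperator hE p₁ b₁
  obtain ⟨ξ, k, hξ⟩ := exists_representation_of_isPositiveOperator hE p₂ b₂
  let μ : regularMeasures X E :=
    ⟨ν - ξ, Submodule.sub_mem _ (Submodule.subset_span h) (Submodule.subset_span k)⟩
  refine ⟨μ, Subtype.ext (sub_eq_zero.1 ?_)⟩
  refine IsNormToOrderBounded.eq_zero hF (integrationMap E hE hF μ - T).2 fun g => ?_
  rw [LinearMap.sub_apply, integrationMap_apply,
    show ⇑(j g) = g from funext (hF.apply_eq g),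
    regularOrderIntegral_eq hE h k rfl (isBoundedMeasurable_compactlySupported g), hν, hξ,
    ← LinearMap.sub_apply, ← hT]
  exact sub_self _

/-- The infimum is attained by integration against `a = |μ|`. Conversely, any `S` dominating `±I_μ`
dominates on `C_c(X)` the modulus of the restriction, whose representing measure majorizes `|μ|`;
inner regularity at `X` recovers the total mass from functions bounded by `1`. -/
theorem regularNorm_integrationMap (hF : IsFunctionSpace j) (μ : regularMeasures X E) :
    regularNorm (integrationMap E hE hF μ).1 = regularMeasureNorm μ := by
  obtain ⟨a, ha, ha0⟩ := exists_isLUB_neg hE μ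
  rw [regularMeasureNorm_eq hE ha]
  refine IsLeast.csInf_eq ⟨⟨norm_nonneg _, (integrationMap E hE hF a).1, fun f hf => ⟨?_, ?_⟩,
    fun f hf => ?_⟩, ?_⟩
  · exact integrationMap_mono hE hF (ha.1 (.inl rfl)) f hf
  · have := integrationMap_mono hE hF (ha.1 (.inr rfl)) f hf
    rwa [map_neg] at this
  · rw [integrationMap_apply, regularOrderIntegral_of_nonneg hE ha0 (hF.isBoundedMeasurable f)]
    refine norm_le_norm_of_abs_le_abs ?_
    rw [abs_of_nonneg (ha0 ⊤)]
    have := (isPosRegularMeasure_of_nonneg hE ha0).abs_realOrderIntegral_le hE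
      (hF.isBoundedMeasurable f) hf
    rwa [one_smul] at this
  · rintro c ⟨-, S, hS, hSc⟩
    obtain ⟨T₁, T₂, p₁, p₂, b₁, b₂, hT, hmin⟩ := exists_positive_decomposition hE
      (IsNormToOrderBounded.comp_inclusion hF (integrationMap E hE hF μ).2)
    obtain ⟨ν, h, hν⟩ := exists_representation_of_isPositiveOperator hE p₁ b₁
    obtain ⟨ξ, k, hξ⟩ := exists_representation_of_isPositiveOperator hE p₂ b₂
    have hpos : ∀ {f : C_c(X, ℝ)}, (∀ x, 0 ≤ f x) → ∀ x, 0 ≤ j f x := fun hf x => by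
      rw [hF.apply_eq]
      exact hf x
    have hmin' := hmin (S ∘ₗ j) fun f hf => hS (j f) (hpos hf)
    -- Both sides integrate `C_c(X)` alike, so the order-reflecting property on `C_c(X)` identifies
    -- them.
    have hμ : μ.1 = ν - ξ := by
      let μ' : regularMeasures X E :=
        ⟨ν - ξ, Submodule.sub_mem _ (Submodule.subset_span h) (Submodule.subset_span k)⟩
      have heq : ∀ f : C_c(X, ℝ), regularOrderIntegral μ f = regularOrderIntegral μ' f := by
        intro f
        have h1 := congrArg (fun T : C_c(X, ℝ) →ₗ[ℝ] E => T f) hT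
        simp only [LinearMap.comp_apply, integrationMap_apply, LinearMap.sub_apply,
          show ⇑(j f) = f from funext (hF.apply_eq f)] at h1
        rw [h1, regularOrderIntegral_eq hE h k rfl (isBoundedMeasurable_compactlySupported f),
          hν, hξ]
      have hle := fun ρ ρ' => (integrationMap_le_iff hE
        (isFunctionSpace_compactlySupported (X := X)) (E := E) ρ ρ').1
      exact congrArg Subtype.val (le_antisymm (hle μ μ' fun f _ => (heq f).le)
        (hle μ' μ fun f _ => (heq f).ge))
    have hsum := h.add hE k
    let b : regularMeasures X E := ⟨ν + ξ, Submodule.subset_span hsum⟩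
    have hab : a ≤ b := ha.2 (by
      rintro ρ (hρ | hρ) A <;> rw [hρ]
      · change μ.1 A ≤ ν A + ξ A
        rw [hμ]
        exact (sub_le_self _ (k.nonneg A)).trans (le_add_of_nonneg_right (k.nonneg A))
      · change -μ.1 A ≤ ν A + ξ A
        rw [hμ, Pi.sub_apply, neg_sub]
        exact (sub_le_self _ (h.nonneg A)).trans (le_add_of_nonneg_left (h.nonneg A)))
    refine (norm_le_norm_of_nonneg_of_le (ha0 ⊤) (hab ⊤)).trans
      (le_of_forall_pos_le_add fun ε hε => ?_)
    -- The constant `1` need not lie in `F`. A bump function equal to `1` on a compact `K` carrying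
    -- all but `ε` of the mass replaces it.
    obtain ⟨K, hK, hKV, hlt⟩ := hsum.exists_isCompact hE (V := ⊤) isOpen_univ hε
    obtain ⟨f, hf, h1, -⟩ := hsum.exists_le_realOrderIntegral hE hK (V := ⊤) isOpen_univ hKV
    have hfm := isBoundedMeasurable_compactlySupported f
    rw [realOrderIntegral_add hE h.toIsPosMeasure k.toIsPosMeasure hfm, hν, hξ] at h1
    have h2 : ‖(ν + ξ) K‖ ≤ ‖S (j f)‖ := norm_le_norm_of_nonneg_of_le (hsum.nonneg K)
      (h1.trans (hmin' f fun x => (hf x).1))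
    have h3 : ‖S (j f)‖ ≤ c := hSc (j f) fun x => by
      rw [hF.apply_eq, abs_of_nonneg (hf x).1]
      exact (hf x).2
    rw [hsum.toIsPosMeasure.isContent.diff hKV] at hlt
    have h4 := norm_le_norm_add_norm_sub' ((ν + ξ) ⊤) ((ν + ξ) K)
    change ‖(ν + ξ) ⊤‖ ≤ c + ε
    linarith

/-- Integration is an isometric isomorphism of vector lattices. -/
theorem exists_integrationEquiv (hF : IsFunctionSpace j) :
    ∃ Φ : regularMeasures X E ≃ₗ[ℝ] nobOperators F E,
      (∀ μ (f : F), (Φ μ).1 f = regularOrderIntegral μ f) ∧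
      IsIsometricLatticeIso regularMeasureNorm (fun T => regularNorm T.1) Φ := by
  have hle := integrationMap_le_iff (E := E) hE hF
  refine ⟨LinearEquiv.ofBijective (integrationMap E hE hF) ⟨fun μ ρ h => ?_,
    integrationMap_surjective hE hF⟩, fun μ f => rfl,
    .of_le_iff hle (regularNorm_integrationMap hE hF)⟩
  exact le_antisymm ((hle μ ρ).1 (by rw [h])) ((hle ρ μ).1 (by rw [h]))

end Isomorphism

/-! ### Compact `X`: regular operators on `C(X)`. -/

section Compact

variable {X : Type*} [TopologicalSpace X] [CompactSpace X]
variable {F : Type*} [AddCommGroup F] [Module ℝ F] [FunLike F X ℝ]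
variable {E : Type*} [NormedAddCommGroup E] [NormedSpace ℝ E] [Lattice E] [IsOrderedAddMonoid E]
  [HasSolidNorm E] [IsOrderedModule ℝ E] [CompleteSpace E]

variable (X) in
/-- `C_c(X) = C(X)` for compact `X`. -/
def compactlySupportedEquiv : C_c(X, ℝ) ≃ₗ[ℝ] C(X, ℝ) where
  toFun f := f.toContinuousMap
  invFun f := CompactlySupportedContinuousMap.continuousMapEquiv f
  map_add' _ _ := rfl
  map_smul' _ _ := rfl
  left_inv _ := rfl
  right_inv _ := rfl

variable (X) in
/-- `C₀(X) = C(X)` for compact `X`. -/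
def zeroAtInftyEquiv : C₀(X, ℝ) ≃ₗ[ℝ] C(X, ℝ) where
  toFun f := f.toContinuousMap
  invFun f := ZeroAtInftyContinuousMap.ContinuousMap.liftZeroAtInfty f
  map_add' _ _ := rfl
  map_smul' _ _ := rfl
  left_inv _ := rfl
  right_inv _ := rfl

/-- On compact `X` the constant `1` is an order unit: a positive `T` satisfies `|T f| ≤ c • T 1`
when `|f| ≤ c`, so regular operators are norm to order bounded. The converse is the
Riesz–Kantorovich decomposition, carried over from `C_c(X) = C(X)`. -/
theorem mem_nobOperators_iff_isRegularOperator (hE : IsOrderContinuousNorm E (fun e => ‖e‖))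
    (ι : F ≃ₗ[ℝ] C(X, ℝ)) (hι : ∀ f x, ι f x = f x) (T : C(X, ℝ) →ₗ[ℝ] E) :
    T ∘ₗ ι.toLinearMap ∈ nobOperators F E ↔ IsRegularOperator T := by
  constructor
  · intro h
    let κ := compactlySupportedEquiv X
    have hn : IsNormToOrderBounded (T ∘ₗ κ.toLinearMap) := by
      rintro S ⟨c, hc⟩
      obtain ⟨e, he⟩ := h ((fun f => ι.symm (κ f)) '' S) ⟨c, by
        rintro _ ⟨f, hf, rfl⟩ x
        simp only
        rw [← hι, ι.apply_symm_apply]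
        exact hc f hf x⟩
      refine ⟨e, fun f hf => ?_⟩
      have := he _ ⟨f, hf, rfl⟩
      simpa using this
    obtain ⟨T₁, T₂, p₁, p₂, -, -, hT, -⟩ := exists_positive_decomposition hE hn
    refine ⟨T₁ ∘ₗ κ.symm.toLinearMap, T₂ ∘ₗ κ.symm.toLinearMap, fun f hf => p₁ _ hf,
      fun f hf => p₂ _ hf, ?_⟩
    rw [← LinearMap.sub_comp, ← hT]
    rfl
  · rintro ⟨T₁, T₂, p₁, p₂, rfl⟩
    have key : ∀ {T : C(X, ℝ) →ₗ[ℝ] E}, IsPositiveOperator T →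
        T ∘ₗ ι.toLinearMap ∈ nobOperators F E := by
      rintro T hT S ⟨c, hc⟩
      have hb : ∀ g : C(X, ℝ), (∀ x, g x ≤ c) → T g ≤ c • T 1 := fun g hg => by
        rw [← map_smul]
        refine hT.mono (fun _ _ _ => rfl) fun x => ?_
        simpa using hg x
      refine ⟨c • T 1, fun f hf => abs_le'.2 ⟨hb (ι f) fun x => ?_, ?_⟩⟩
      · rw [hι]
        exact (le_abs_self _).trans (hc f hf x)
      · rw [← map_neg, LinearMap.comp_apply, map_neg]
        refine hb (-ι f) fun x => ?_
        rw [ContinuousMap.neg_apply, hι]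
        exact (neg_le_abs _).trans (hc f hf x)
    rw [LinearMap.sub_comp]
    exact Submodule.sub_mem _ (key p₁) (key p₂)

end Compact

end VectorRiesz

/-! ### The main theorem. -/

theorem mainTheorem2
    {X : Type*} [TopologicalSpace X] [T2Space X] [LocallyCompactSpace X] [Nonempty X]
    [MeasurableSpace X] [BorelSpace X]
    {E : Type*} [NormedAddCommGroup E] [NormedSpace ℝ E] [Lattice E] [IsOrderedAddMonoid E]
    [IsOrderedModule ℝ E] [HasSolidNorm E] [CompleteSpace E]
    (hE : IsOrderContinuousNorm E (fun e => ‖e‖)) :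
    -- the three spaces are Banach lattices
    IsBanachLattice (regularMeasures X E) regularMeasureNorm ∧
    IsBanachLattice (nobOperators C_c(X, ℝ) E) (fun T => regularNorm T.1) ∧
    IsBanachLattice (nobOperators C₀(X, ℝ) E) (fun T => regularNorm T.1) ∧
    -- integration is an isometric lattice isomorphism onto the operators on `C_c(X)`
    (∃ Φ : regularMeasures X E ≃ₗ[ℝ] nobOperators C_c(X, ℝ) E,
      (∀ μ (f : C_c(X, ℝ)), (Φ μ).1 f = regularOrderIntegral μ f) ∧
      IsIsometricLatticeIso regularMeasureNorm (fun T => regularNorm T.1) Φ) ∧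
    -- integration is an isometric lattice isomorphism onto the operators on `C₀(X)`
    (∃ Φ : regularMeasures X E ≃ₗ[ℝ] nobOperators C₀(X, ℝ) E,
      (∀ μ (f : C₀(X, ℝ)), (Φ μ).1 f = regularOrderIntegral μ f) ∧
      IsIsometricLatticeIso regularMeasureNorm (fun T => regularNorm T.1) Φ) ∧
    -- AL-spaces
    (IsALNorm (regularMeasures X E) regularMeasureNorm ↔ IsALNorm E (fun e => ‖e‖)) ∧
    (IsALNorm (nobOperators C_c(X, ℝ) E) (fun T => regularNorm T.1) ↔
      IsALNorm E (fun e => ‖e‖)) ∧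
    (IsALNorm (nobOperators C₀(X, ℝ) E) (fun T => regularNorm T.1) ↔
      IsALNorm E (fun e => ‖e‖)) ∧
    -- Levi norms
    (IsLeviNorm (regularMeasures X E) regularMeasureNorm ↔ IsLeviNorm E (fun e => ‖e‖)) ∧
    (IsLeviNorm (nobOperators C_c(X, ℝ) E) (fun T => regularNorm T.1) ↔
      IsLeviNorm E (fun e => ‖e‖)) ∧
    (IsLeviNorm (nobOperators C₀(X, ℝ) E) (fun T => regularNorm T.1) ↔
      IsLeviNorm E (fun e => ‖e‖)) ∧
    -- KB-spaces
    (IsKBNorm (regularMeasures X E) regularMeasureNorm ↔ IsKBNorm E (fun e => ‖e‖)) ∧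
    (IsKBNorm (nobOperators C_c(X, ℝ) E) (fun T => regularNorm T.1) ↔
      IsKBNorm E (fun e => ‖e‖)) ∧
    (IsKBNorm (nobOperators C₀(X, ℝ) E) (fun T => regularNorm T.1) ↔
      IsKBNorm E (fun e => ‖e‖)) ∧
    -- for compact `X` both spaces of operators coincide with the regular operators on `C(X)`,
    -- under the identifications `C_c(X) = C(X)` and `C₀(X) = C(X)`
    (CompactSpace X →
      (∃ ι : C_c(X, ℝ) ≃ₗ[ℝ] C(X, ℝ), (∀ f x, ι f x = f x) ∧
        ∀ T : C(X, ℝ) →ₗ[ℝ] E,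
          T ∘ₗ ι.toLinearMap ∈ nobOperators C_c(X, ℝ) E ↔ IsRegularOperator T) ∧
      (∃ ι : C₀(X, ℝ) ≃ₗ[ℝ] C(X, ℝ), (∀ f x, ι f x = f x) ∧
        ∀ T : C(X, ℝ) →ₗ[ℝ] E,
          T ∘ₗ ι.toLinearMap ∈ nobOperators C₀(X, ℝ) E ↔ IsRegularOperator T)) := by
  obtain ⟨Φ, hΦ, h⟩ := exists_integrationEquiv hE (isFunctionSpace_compactlySupported (X := X))
  obtain ⟨Ψ, hΨ, k⟩ := exists_integrationEquiv hE (isFunctionSpace_zeroAtInfty (X := X))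
  have hBL := isBanachLattice_regularMeasures (X := X) hE
  have hAL := isALNorm_regularMeasures_iff (X := X) hE
  have hLevi := isLeviNorm_regularMeasures_iff (X := X) hE
  have hKB := isKBNorm_regularMeasures_iff (X := X) hE
  exact ⟨hBL, h.isBanachLattice hBL, k.isBanachLattice hBL, ⟨Φ, hΦ, h⟩, ⟨Ψ, hΨ, k⟩,
    hAL, h.isALNorm_iff.trans hAL, k.isALNorm_iff.trans hAL,
    hLevi, h.isLeviNorm_iff.trans hLevi, k.isLeviNorm_iff.trans hLevi,
    hKB, h.isKBNorm_iff.trans hKB, k.isKBNorm_iff.trans hKB,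
    fun _ => ⟨⟨compactlySupportedEquiv X, fun _ _ => rfl,
      mem_nobOperators_iff_isRegularOperator hE _ fun _ _ => rfl⟩,
      ⟨zeroAtInftyEquiv X, fun _ _ => rfl,
      mem_nobOperators_iff_isRegularOperator hE _ fun _ _ => rfl⟩⟩⟩
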